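/- For a rational polytope $P\subset\mathbb{R}^m$ (the convex hull of a nonempty finite set of points of $\mathbb{Q}^m$), its denominator is the smallest integer $q\ge 1$ such that $qP$ is a lattice polytope (the convex hull of finitely many points of $\mathbb{Z}^m$), and $\operatorname{Ehr}_P(z)=1+\sum_{k\ge1}|kP\cap\mathbb{Z}^m|\,z^k$ is its Ehrhart series. Let $d\ge 1$, let $P\subset\mathbb{R}^{d-1}$ be a rational polytope with denominator $q$, and identify $\mathbb{R}^{d-1}$ with $\mathbb{R}^{d-1}\times\{0\}\subset\mathbb{R}^d$. For $x\in\mathbb{R}^d$ let $\operatorname{Pyr}(x,P)=\operatorname{conv}(\{x\}\cup P)\subset\mathbb{R}^d$, and let $e_d$ be the $d$-th unit vector. 1. The power series $$(1-z^q)^d\operatorname{Ehr}_P(z)\quad\text{and}\quad (1-z^q)^d(1-z)\operatorname{Ehr}_{\operatorname{Pyr}(e_d,P)}(z)$$ are polynomials with integer coefficients, and they are equal. 2. Put $D=\dim P+1$ (so $D=d$ if $P$ is full-dimensional). Let $r\ge1$ be an integer and let $x\in\frac1r\mathbb{Z}^d$ be a point that does not lie in the affine span of $P$. Then $$h^*_P(z)=(1-z^q)^{D}\operatorname{Ehr}_P(z)\quad\text{and}\quad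 h^*_{\operatorname{Pyr}(x,P)}(z)=(1-z^q)^{D}(1-z^r)\operatorname{Ehr}_{\operatorname{Pyr}(x,P)}(z)$$ are polynomials with integer coefficients, and $h^*_P(z)\le h^*_{\operatorname{Pyr}(x,P)}(z)$ coefficientwise. -/

import Mathlib

open scoped Polynomial PowerSeries Pointwise

/-- A point of `ℝ^ι` all of whose coordinates are integers. -/
def IsIntegralPoint {ι : Type*} (v : ι → ℝ) : Prop :=
  ∀ i, ∃ a : ℤ, v i = (a : ℝ)

/-- A lattice polytope: the convex hull of a nonempty finite set of points of `ℤ^ι`. -/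
def IsLatticePolytope {ι : Type*} (P : Set (ι → ℝ)) : Prop :=
  ∃ V : Finset (ι → ℝ), V.Nonempty ∧ (∀ v ∈ V, IsIntegralPoint v) ∧
    P = convexHull ℝ (V : Set (ι → ℝ))

/-- A rational polytope: the convex hull of a nonempty finite set of points of `ℚ^ι`. -/
def IsRationalPolytope {ι : Type*} (P : Set (ι → ℝ)) : Prop :=
  ∃ V : Finset (ι → ℝ), V.Nonempty ∧ (∀ v ∈ V, ∀ i, ∃ a : ℚ, v i = (a : ℝ)) ∧
    P = convexHull ℝ (V : Set (ι → ℝ))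

/-- `q` is the denominator of `P`: the smallest positive integer such that the dilate `q P`
is a lattice polytope. -/
def IsDenominator {ι : Type*} (P : Set (ι → ℝ)) (q : ℕ) : Prop :=
  IsLeast {k : ℕ | 0 < k ∧ IsLatticePolytope ((k : ℝ) • P)} q

/-- The number of integer points in the dilate `k P`. -/
noncomputable def ehrhartCount {ι : Type*} (P : Set (ι → ℝ)) (k : ℕ) : ℕ :=
  Set.ncard {v : ι → ℝ | v ∈ (k : ℝ) • P ∧ IsIntegralPoint v}

/-- The Ehrhart series `1 + ∑_{k ≥ 1} |k P ∩ ℤ^ι| z^k`. -/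
noncomputable def ehrhartSeries {ι : Type*} (P : Set (ι → ℝ)) : ℤ⟦X⟧ :=
  PowerSeries.mk fun k => if k = 0 then 1 else (ehrhartCount P k : ℤ)

/-- The dimension of `P`, that is, of its affine span (for nonempty `P`). -/
noncomputable def polytopeDim {ι : Type*} (P : Set (ι → ℝ)) : ℕ :=
  Module.finrank ℝ (vectorSpan ℝ P)

/-- The copy `P × {0}` in `ℝ^(n+1)` of a subset `P` of `ℝ^n`. -/
def liftToHyperplane {n : ℕ} (P : Set (Fin n → ℝ)) : Set (Fin (n + 1) → ℝ) :=
  (fun v => (Fin.snoc v 0 : Fin (n + 1) → ℝ)) '' P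

/-- The pyramid with apex `x ∈ ℝ^(n+1)` over `P ⊆ ℝ^n = ℝ^n × {0}`. -/
def Pyr {n : ℕ} (x : Fin (n + 1) → ℝ) (P : Set (Fin n → ℝ)) : Set (Fin (n + 1) → ℝ) :=
  convexHull ℝ (insert x (liftToHyperplane P))

/-! Homogenise: if `qP` is the convex hull of lattice points `v i`, the cone `C` generated by the
vectors `(v i, q)` has the dilate `kP` as its slice at height `k`, so counting lattice points of `C`
by height gives the Ehrhart series. The cone over the pyramid is the disjoint union of the
translates `C + t • (x, 1)`, `t ≥ 0`; disjointness holds because `(x, 1)` lies outside the span of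
`C`. Since `r • (x, 1)` is a lattice point, multiplication by `1 - z^r` keeps exactly the translates
with `0 ≤ t < r`, of which finitely many contain lattice points
(`one_sub_X_pow_mul_levelSeries_pyramid`).

The translate `t = 0` contributes `h*_P`. Every other translate contributes a polynomial with
nonnegative coefficients after multiplication by `(1 - z^q)^D` (`isNonnegPolynomial_shiftedCone`),
which gives the inequality. For the apex `e_d` the last coordinate of a lattice point in a translate
is `t` itself, so only `t = 0` survives and equality holds.

Nonnegativity for a translate comes from cutting `C` into disjoint half-open simplicial cones of
dimension `D`. In each of them multiplication by `(1 - z^q)^D` leaves the lattice points of a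
bounded half-open parallelepiped. -/

open Filter Topology

/-! ### Generating functions of sets graded by height -/

section LevelSeries

variable {E : Type*} [AddCommGroup E] [Module ℝ E]

/-- The generating function counting the points of `S` by their height. -/
noncomputable def levelSeries (ht : E →ₗ[ℝ] ℝ) (S : Set E) : ℤ⟦X⟧ :=
  PowerSeries.mk fun k => (Set.ncard {u | u ∈ S ∧ ht u = k} : ℤ)

/-- `S` has finitely many points of each height. -/
def LevelFinite (ht : E →ₗ[ℝ] ℝ) (S : Set E) : Prop :=
  ∀ k : ℕ, {u | u ∈ S ∧ ht u = k}.Finite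

theorem LevelFinite.mono {ht : E →ₗ[ℝ] ℝ} {S T : Set E} (hT : LevelFinite ht T) (h : S ⊆ T) :
    LevelFinite ht S :=
  fun k => (hT k).subset fun _ hu => ⟨h hu.1, hu.2⟩

theorem levelSeries_empty (ht : E →ₗ[ℝ] ℝ) : levelSeries ht ∅ = 0 := by
  ext k
  simp [levelSeries]

theorem levelSeries_union (ht : E →ₗ[ℝ] ℝ) {S T : Set E} (hS : LevelFinite ht S)
    (hT : LevelFinite ht T) (hd : Disjoint S T) :
    levelSeries ht (S ∪ T) = levelSeries ht S + levelSeries ht T := by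
  ext k
  simp only [levelSeries, PowerSeries.coeff_mk, map_add]
  rw [← Nat.cast_add, ← Set.ncard_union_eq _ (hS k) (hT k)]
  · congr 2
    ext u
    simp only [Set.mem_ofPred_eq, Set.mem_union]
    tauto
  · rw [Set.disjoint_left] at hd ⊢
    exact fun u hu hu' => hd hu.1 hu'.1

theorem LevelFinite.biUnion {ι : Type*} (ht : E →ₗ[ℝ] ℝ) (s : Finset ι) (A : ι → Set E)
    (hfin : ∀ i ∈ s, LevelFinite ht (A i)) : LevelFinite ht (⋃ i ∈ s, A i) := by
  intro k
  refine (s.finite_toSet.biUnion fun i hi => hfin i hi k).subset ?_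
  rintro u ⟨hu, hk⟩
  simp only [Set.mem_iUnion] at hu ⊢
  obtain ⟨i, hi, hu⟩ := hu
  exact ⟨i, hi, hu, hk⟩

theorem levelSeries_biUnion {ι : Type*} (ht : E →ₗ[ℝ] ℝ) (s : Finset ι) (A : ι → Set E)
    (hfin : ∀ i ∈ s, LevelFinite ht (A i))
    (hd : ∀ i ∈ s, ∀ j ∈ s, i ≠ j → Disjoint (A i) (A j)) :
    levelSeries ht (⋃ i ∈ s, A i) = ∑ i ∈ s, levelSeries ht (A i) := by
  classical
  induction s using Finset.induction_on with
  | empty => simp [levelSeries_empty]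
  | insert i s hi ih =>
    rw [Finset.sum_insert hi, Finset.set_biUnion_insert, levelSeries_union, ih]
    · exact fun j hj => hfin j (Finset.mem_insert_of_mem hj)
    · exact fun j hj l hl => hd j (Finset.mem_insert_of_mem hj) l (Finset.mem_insert_of_mem hl)
    · exact hfin i (Finset.mem_insert_self i s)
    · exact LevelFinite.biUnion ht s A fun j hj => hfin j (Finset.mem_insert_of_mem hj)
    · simp only [Set.disjoint_iUnion_right]
      intro j hj
      exact hd i (Finset.mem_insert_self i s) j (Finset.mem_insert_of_mem hj)
        (fun h => hi (h ▸ hj))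

/-- Multiplication by `X ^ q` counts the translate `S + b`, which lies inside `S`, so the difference
counts what is left. Nonnegative heights ensure that `S + b` has no point below height `q`. -/
theorem one_sub_X_pow_mul_levelSeries (ht : E →ₗ[ℝ] ℝ) {S : Set E} {b : E} {q : ℕ}
    (hb : ht b = q) (hS : LevelFinite ht S) (hnn : ∀ u ∈ S, 0 ≤ ht u)
    (hadd : ∀ u ∈ S, u + b ∈ S) :
    (1 - PowerSeries.X ^ q) * levelSeries ht S = levelSeries ht {u | u ∈ S ∧ u - b ∉ S} := by
  ext k
  rw [sub_mul, one_mul, map_sub, PowerSeries.coeff_X_pow_mul']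
  simp only [levelSeries, PowerSeries.coeff_mk, Set.mem_ofPred_eq]
  have hsplit : {u | u ∈ S ∧ ht u = k} = {u | (u ∈ S ∧ u - b ∉ S) ∧ ht u = k} ∪
      {u | u - b ∈ S ∧ ht u = k} := by
    ext u
    simp only [Set.mem_ofPred_eq, Set.mem_union]
    have := hadd (u - b)
    rw [sub_add_cancel] at this
    tauto
  have hcard : Set.ncard {u | u ∈ S ∧ ht u = k} =
      Set.ncard {u | (u ∈ S ∧ u - b ∉ S) ∧ ht u = k} + Set.ncard {u | u - b ∈ S ∧ ht u = k} := by
    conv_lhs => rw [hsplit]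
    apply Set.ncard_union_eq
    · rw [Set.disjoint_left]
      exact fun u hu hu' => hu.1.2 hu'.1
    · exact (hS k).subset fun u hu => ⟨hu.1.1, hu.2⟩
    · refine (hS k).subset fun u hu => ⟨?_, hu.2⟩
      simpa using hadd _ hu.1
  have hshift : Set.ncard {u | u - b ∈ S ∧ ht u = k} =
      if q ≤ k then Set.ncard {u | u ∈ S ∧ ht u = ((k - q : ℕ) : ℝ)} else 0 := by
    split_ifs with h
    · rw [← Set.ncard_image_of_injective {u | u ∈ S ∧ ht u = ((k - q : ℕ) : ℝ)}
        (add_left_injective b)]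
      congr 1
      ext u
      simp only [Set.mem_ofPred_eq, Set.mem_image, Nat.cast_sub h]
      constructor
      · rintro ⟨hu, hk⟩
        exact ⟨u - b, ⟨hu, by rw [map_sub, hk, hb]⟩, sub_add_cancel u b⟩
      · rintro ⟨w, ⟨hw, hk⟩, rfl⟩
        exact ⟨by simpa using hw, by rw [map_add, hk, hb]; ring⟩
    · have : {u | u - b ∈ S ∧ ht u = k} = ∅ := by
        rw [Set.eq_empty_iff_forall_notMem]
        rintro u ⟨hu, hk⟩
        have h0 := hnn _ hu
        rw [map_sub, hk, hb, sub_nonneg, Nat.cast_le] at h0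
        exact h h0
      rw [this, Set.ncard_empty]
  rw [hcard, hshift]
  split_ifs <;> push_cast <;> ring

/-- The power series `F` is a polynomial with nonnegative coefficients. -/
def IsNonnegPolynomial (F : ℤ⟦X⟧) : Prop :=
  ∃ p : ℤ[X], (p : ℤ⟦X⟧) = F ∧ ∀ i, 0 ≤ p.coeff i

theorem IsNonnegPolynomial.sum {ι : Type*} (s : Finset ι) (F : ι → ℤ⟦X⟧)
    (h : ∀ i ∈ s, IsNonnegPolynomial (F i)) : IsNonnegPolynomial (∑ i ∈ s, F i) := by
  classical
  induction s using Finset.induction_on with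
  | empty => exact ⟨0, by simp, by simp⟩
  | insert i s hi ih =>
    obtain ⟨p, hp, hp0⟩ := h i (Finset.mem_insert_self i s)
    obtain ⟨p', hp', hp0'⟩ := ih fun j hj => h j (Finset.mem_insert_of_mem hj)
    refine ⟨p + p', by rw [Finset.sum_insert hi, Polynomial.coe_add, hp, hp'], fun j => ?_⟩
    rw [Polynomial.coeff_add]
    exact add_nonneg (hp0 j) (hp0' j)

theorem isNonnegPolynomial_levelSeries (ht : E →ₗ[ℝ] ℝ) {S : Set E} (M : ℝ)
    (hM : ∀ u ∈ S, ht u ≤ M) : IsNonnegPolynomial (levelSeries ht S) := by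
  obtain ⟨m, hm⟩ := exists_nat_gt M
  refine ⟨PowerSeries.trunc m (levelSeries ht S), ?_, fun i => ?_⟩
  · ext k
    rw [Polynomial.coeff_coe, PowerSeries.coeff_trunc]
    split_ifs with h
    · rfl
    · have : {u | u ∈ S ∧ ht u = k} = ∅ := by
        rw [Set.eq_empty_iff_forall_notMem]
        rintro u ⟨hu, hk⟩
        have h1 := hM u hu
        have h2 : (m : ℝ) ≤ k := by exact_mod_cast not_lt.1 h
        linarith
      simp [levelSeries, this]
  · rw [PowerSeries.coeff_trunc]
    split_ifs
    · simp [levelSeries]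
    · exact le_rfl

end LevelSeries

/-! ### The lexicographic triangulation of a cone -/

section Triangulation

variable {ι : Type*} [LinearOrder ι]

/-- The first nonzero entry of `μ` exists and is negative. -/
def LexNeg (μ : ι → ℝ) : Prop := ∃ i, (∀ j < i, μ j = 0) ∧ μ i < 0

theorem LexNeg.toLex_add_smul_lt {μ : ι → ℝ} (h : LexNeg μ) (c : ι → ℝ) {ε : ℝ} (hε : 0 < ε) :
    toLex (c + ε • μ) < toLex c := by
  obtain ⟨i, h0, hi⟩ := h
  refine ⟨i, fun j hj => ?_, ?_⟩
  · simp [h0 j hj]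
  · have := mul_neg_of_pos_of_neg hε hi
    simpa using this

variable [Fintype ι]

theorem lexNeg_or_lexNeg_neg {μ : ι → ℝ} (h : μ ≠ 0) : LexNeg μ ∨ LexNeg (-μ) := by
  have hne : (Finset.univ.filter fun i => μ i ≠ 0).Nonempty := by
    obtain ⟨i, hi⟩ := Function.ne_iff.1 h
    exact ⟨i, by simpa using hi⟩
  obtain ⟨i, hi, hmin⟩ := Finset.exists_min_image _ id hne
  have h0 : ∀ j < i, μ j = 0 := by
    intro j hj
    by_contra hj'
    exact absurd (hmin j (by simpa using hj')) (not_le.2 hj)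
  rcases lt_or_gt_of_ne (Finset.mem_filter.1 hi).2 with h | h
  · exact Or.inl ⟨i, h0, h⟩
  · exact Or.inr ⟨i, fun j hj => by simp [h0 j hj], by simpa using h⟩

variable {E : Type*} [AddCommGroup E] [Module ℝ E] (V : ι → E)

/-- The set of all nonnegative combinations of the vectors `V i`. -/
def generatedCone {ι : Type*} [Fintype ι] {E : Type*} [AddCommGroup E] [Module ℝ E]
    (V : ι → E) : Set E :=
  {u | ∃ c : ι → ℝ, (∀ i, 0 ≤ c i) ∧ ∑ i, c i • V i = u}

/-- The open simplicial cone spanned by the `V i` with `i ∈ B`. -/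
def openCell (B : Finset ι) : Set E :=
  {u | ∃ c : ι → ℝ, (∀ i ∈ B, 0 < c i) ∧ (∀ i ∉ B, c i = 0) ∧ ∑ i, c i • V i = u}

/-- `B` is a face of the lexicographic triangulation of the cone generated by `V`. -/
def IsLexFace (B : Finset ι) : Prop :=
  ∀ μ : ι → ℝ, ∑ i, μ i • V i = 0 → (∀ i ∉ B, 0 ≤ μ i) → ¬ LexNeg μ

variable {V}

/-- A nontrivial relation supported on `B` and its negative both satisfy the sign condition off `B`,
and one of the two is `LexNeg`. -/
theorem IsLexFace.linearIndepOn {B : Finset ι} (hB : IsLexFace V B) :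
    LinearIndepOn ℝ V (B : Set ι) := by
  rw [linearIndepOn_finset_iff]
  intro f hf i hi
  by_contra hne
  set μ : ι → ℝ := fun j => if j ∈ B then f j else 0 with hμ
  have hsum : ∑ j, μ j • V j = 0 := by
    simp only [hμ, ite_smul, zero_smul]
    rw [← Finset.sum_filter]
    simpa using hf
  have hμ0 : μ ≠ 0 := fun h => hne (by simpa [hμ, hi] using congrFun h i)
  rcases lexNeg_or_lexNeg_neg hμ0 with h | h
  · exact hB μ hsum (fun j hj => by simp [hμ, hj]) h
  · exact hB (-μ) (by simp [hsum]) (fun j hj => by simp [hμ, hj]) h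

/-- For two representations of `u`, `c - c'` is nonnegative off `B'` and `c' - c` is nonnegative off
`B`. If they differed, whichever is `LexNeg` would contradict a face condition; so they agree, and
so do their supports. -/
theorem IsLexFace.eq_of_mem_openCell {B B' : Finset ι} (hB : IsLexFace V B)
    (hB' : IsLexFace V B') {u : E} (hu : u ∈ openCell V B) (hu' : u ∈ openCell V B') :
    B = B' := by
  obtain ⟨c, hpos, hzero, hsum⟩ := hu
  obtain ⟨c', hpos', hzero', hsum'⟩ := hu'
  have hnn : ∀ i, 0 ≤ c i := fun i => by
    by_cases h : i ∈ B
    · exact (hpos i h).le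
    · exact (hzero i h).ge
  have hnn' : ∀ i, 0 ≤ c' i := fun i => by
    by_cases h : i ∈ B'
    · exact (hpos' i h).le
    · exact (hzero' i h).ge
  have hcc : c = c' := by
    by_contra hne
    rcases lexNeg_or_lexNeg_neg (sub_ne_zero.2 hne) with h | h
    · refine hB' (c - c') ?_ (fun i hi => ?_) h
      · simp [sub_smul, Finset.sum_sub_distrib, hsum, hsum']
      · simpa [hzero' i hi] using hnn i
    · refine hB (-(c - c')) ?_ (fun i hi => ?_) h
      · simp [sub_smul, Finset.sum_sub_distrib, hsum, hsum']
      · simpa [hzero i hi] using hnn' i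
  subst hcc
  ext i
  constructor
  · intro hi
    by_contra h
    exact (hpos i hi).ne' (hzero' i h)
  · intro hi
    by_contra h
    exact (hpos' i hi).ne' (hzero i h)

/-- Moving from `c` in a direction with a negative entry until a coordinate vanishes. -/
theorem exists_smul_add_nonneg {ι : Type*} [Fintype ι] {c μ : ι → ℝ} (hc : ∀ i, 0 ≤ c i)
    (hμ : ∀ i, c i = 0 → μ i = 0) (hneg : ∃ i, μ i < 0) :
    ∃ t : ℝ, 0 < t ∧ (∀ i, 0 ≤ c i + t * μ i) ∧ ∃ i, c i ≠ 0 ∧ c i + t * μ i = 0 := by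
  have hne : (Finset.univ.filter fun i => μ i < 0).Nonempty := by
    obtain ⟨i, hi⟩ := hneg
    exact ⟨i, by simpa using hi⟩
  obtain ⟨i, hi, hmin⟩ := Finset.exists_min_image _ (fun i => c i / (-μ i)) hne
  have hi' : μ i < 0 := (Finset.mem_filter.1 hi).2
  have hci : c i ≠ 0 := fun h => hi'.ne (hμ i h)
  have hcpos : 0 < c i := lt_of_le_of_ne (hc i) (Ne.symm hci)
  refine ⟨c i / (-μ i), div_pos hcpos (neg_pos.2 hi'), fun j => ?_, i, hci, ?_⟩
  · rcases lt_or_ge (μ j) 0 with hj | hj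
    · have h := hmin j (by simpa using hj)
      rw [le_div_iff₀ (neg_pos.2 hj)] at h
      linarith
    · exact add_nonneg (hc j) (mul_nonneg (div_pos hcpos (neg_pos.2 hi')).le hj)
  · have := hi'.ne
    field_simp
    ring

/-- Every nonnegative representation can be lexicographically decreased to one with linearly
independent support. -/
theorem exists_linearIndepOn_support_le (c : ι → ℝ) (hc : ∀ i, 0 ≤ c i) :
    ∃ c' : ι → ℝ, (∀ i, 0 ≤ c' i) ∧ ∑ i, c' i • V i = ∑ i, c i • V i ∧
      LinearIndepOn ℝ V {i | c' i ≠ 0} ∧ toLex c' ≤ toLex c := by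
  induction hn : (Finset.univ.filter fun i => c i ≠ 0).card using Nat.strong_induction_on
    generalizing c with
  | _ n ih =>
  by_cases hli : LinearIndepOn ℝ V {i | c i ≠ 0}
  · exact ⟨c, hc, rfl, hli, le_rfl⟩
  have hset : {i | c i ≠ 0} = ((Finset.univ.filter fun i => c i ≠ 0 : Finset ι) : Set ι) := by
    ext; simp
  rw [hset, linearIndepOn_finset_iff] at hli
  push Not at hli
  obtain ⟨f, hf, i, hi, hfi⟩ := hli
  obtain ⟨μ, hμsum, hμ, hμneg⟩ : ∃ μ : ι → ℝ, ∑ j, μ j • V j = 0 ∧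
      (∀ j, c j = 0 → μ j = 0) ∧ LexNeg μ := by
    set μ : ι → ℝ := fun j => if c j ≠ 0 then f j else 0 with hμ
    have hsum : ∑ j, μ j • V j = 0 := by
      simp only [hμ, ite_smul, zero_smul]
      rw [← Finset.sum_filter]
      exact hf
    have hμ0 : μ ≠ 0 := fun h => hfi (by
      have := congrFun h i
      have hci : c i ≠ 0 := (Finset.mem_filter.1 hi).2
      simpa [hμ, hci] using this)
    rcases lexNeg_or_lexNeg_neg hμ0 with h | h
    · exact ⟨μ, hsum, fun j hj => by simp [hμ, hj], h⟩
    · exact ⟨-μ, by simp [hsum], fun j hj => by simp [hμ, hj], h⟩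
  obtain ⟨t, ht, hnn, j, hj, hj0⟩ := exists_smul_add_nonneg hc hμ
    (let ⟨i, hi⟩ := hμneg; ⟨i, hi.2⟩)
  have hlt : (Finset.univ.filter fun i => (c + t • μ) i ≠ 0).card < n := by
    rw [← hn]
    apply Finset.card_lt_card
    rw [Finset.ssubset_iff_of_subset]
    · exact ⟨j, by simpa using hj, by simpa using hj0⟩
    · intro l hl
      simp only [Finset.mem_filter, Finset.mem_univ, true_and] at hl ⊢
      intro h
      exact hl (by simp [h, hμ l h])
  obtain ⟨c', h1, h2, h3, h4⟩ := ih _ hlt (c + t • μ) (by simpa using hnn) rfl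
  refine ⟨c', h1, ?_, h3, h4.trans (hμneg.toLex_add_smul_lt c ht).le⟩
  rw [h2]
  simp [add_smul, Finset.sum_add_distrib, mul_smul, ← Finset.smul_sum, hμsum]

/-- The face is the support of the lexicographically least representation of `u`. Restricting to
independent supports makes the candidates finite in number, since the support then determines the
coefficients. A `LexNeg` relation violating the face condition would allow a small decreasing move,
which can be reduced again to independent support, against minimality. -/
theorem exists_isLexFace_mem_openCell {u : E} (hu : u ∈ generatedCone V) :
    ∃ B, IsLexFace V B ∧ u ∈ openCell V B := by
  set F : Set (ι → ℝ) := {c | (∀ i, 0 ≤ c i) ∧ ∑ i, c i • V i = u ∧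
    LinearIndepOn ℝ V {i | c i ≠ 0}} with hF
  have hfin : F.Finite := by
    refine Set.Finite.of_injOn (f := fun c : ι → ℝ => {i | c i ≠ 0}) (t := Set.univ)
      (fun _ _ => Set.mem_univ _) ?_ Set.finite_univ
    intro c hc c' hc' hcc
    simp only at hcc
    have hli := hc.2.2
    have hset : {i | c i ≠ 0} = ((Finset.univ.filter fun i => c i ≠ 0 : Finset ι) : Set ι) := by
      ext; simp
    have hout : ∀ i, c i = 0 → c' i = 0 := by
      intro i hi
      by_contra h
      have : i ∈ {i | c i ≠ 0} := by rw [hcc]; exact h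
      exact this hi
    rw [hset, linearIndepOn_finset_iff] at hli
    have hs : ∑ i ∈ Finset.univ.filter (fun i => c i ≠ 0), (c - c') i • V i = 0 := by
      rw [Finset.sum_filter_of_ne]
      · simp [sub_smul, Finset.sum_sub_distrib, hc.2.1, hc'.2.1]
      · intro i _ hi h
        simp [h, hout i h] at hi
    have := hli (c - c') hs
    ext i
    by_cases hi : c i = 0
    · rw [hi, hout i hi]
    · exact sub_eq_zero.1 (this i (by simpa using hi))
  have hne : F.Nonempty := by
    obtain ⟨c, hc, hcu⟩ := hu
    obtain ⟨c', h1, h2, h3, -⟩ := exists_linearIndepOn_support_le (V := V) c hc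
    exact ⟨c', h1, h2.trans hcu, h3⟩
  obtain ⟨c, hc, hmin⟩ := Set.exists_min_image F toLex hfin hne
  refine ⟨Finset.univ.filter fun i => c i ≠ 0, ?_, c, fun i hi => ?_, fun i hi => ?_, hc.2.1⟩
  · intro μ hμ hμB hneg
    have hev : ∃ ε : ℝ, 0 < ε ∧ ∀ i, 0 ≤ c i + ε * μ i := by
      have : ∀ᶠ ε in 𝓝[>] (0 : ℝ), 0 < ε ∧ ∀ i, 0 ≤ c i + ε * μ i := by
        refine Eventually.and self_mem_nhdsWithin (eventually_all.2 fun i => ?_)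
        by_cases hi : c i = 0
        · filter_upwards [self_mem_nhdsWithin] with ε hε
          have := hμB i (by simpa using hi)
          rw [hi, zero_add]
          exact mul_nonneg (le_of_lt hε) this
        · have hpos : 0 < c i := lt_of_le_of_ne (hc.1 i) (Ne.symm hi)
          have hcont : Tendsto (fun ε : ℝ => c i + ε * μ i) (𝓝[>] 0) (𝓝 (c i + 0 * μ i)) :=
            ((continuous_const.add (continuous_id.mul continuous_const)).tendsto 0).mono_left
              nhdsWithin_le_nhds
          rw [zero_mul, add_zero] at hcont
          exact (hcont.eventually (lt_mem_nhds hpos)).mono fun _ h => h.le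
      exact this.exists
    obtain ⟨ε, hε, hnn⟩ := hev
    obtain ⟨c', h1, h2, h3, h4⟩ := exists_linearIndepOn_support_le (V := V) (c + ε • μ)
      (by simpa using hnn)
    have hmem : c' ∈ F := by
      refine ⟨h1, ?_, h3⟩
      rw [h2]
      simp [add_smul, Finset.sum_add_distrib, mul_smul, ← Finset.smul_sum, hμ, hc.2.1]
    exact absurd (hmin c' hmem) (not_le.2 (h4.trans_lt (hneg.toLex_add_smul_lt c hε)))
  · exact lt_of_le_of_ne (hc.1 i) (Ne.symm (by simpa using hi))
  · simpa using hi

end Triangulation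

/-! ### Disjoint half-open cells from a generic direction -/

section HalfOpenDecomposition

variable {E : Type*} [AddCommGroup E] [Module ℝ E]

/-- A line with direction outside `W` meets `W` in at most one point. -/
theorem eventually_add_smul_notMem (W : Submodule ℝ E) {g : E} (hg : g ∉ W) (u : E) :
    ∀ᶠ ε in 𝓝[>] (0 : ℝ), u + ε • g ∉ W := by
  by_cases h : ∃ ε₀ : ℝ, 0 < ε₀ ∧ u + ε₀ • g ∈ W
  · obtain ⟨ε₀, h0, hmem⟩ := h
    filter_upwards [Ioo_mem_nhdsGT h0] with ε hε hmem'
    have h1 := W.sub_mem hmem hmem'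
    rw [add_sub_add_left_eq_sub, ← sub_smul] at h1
    exact hg ((W.smul_mem_iff (sub_pos.2 hε.2).ne').1 h1)
  · push Not at h
    filter_upwards [self_mem_nhdsWithin] with ε hε
    exact h ε hε

variable {ι : Type*} [Fintype ι]

/-- A positive combination of the `V i` avoiding all proper subspaces spanned by some of them. -/
theorem exists_generic_combination (V : ι → E) :
    ∃ g ∈ Submodule.span ℝ (Set.range V), (∃ c : ι → ℝ, (∀ i, 0 < c i) ∧ ∑ i, c i • V i = g) ∧
      ∀ B : Finset ι, Submodule.span ℝ (V '' B) ≠ Submodule.span ℝ (Set.range V) →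
        g ∉ Submodule.span ℝ (V '' B) := by
  classical
  set Φ : (ι → ℝ) →ₗ[ℝ] E := Fintype.linearCombination ℝ V with hΦ
  have hrange : ∀ c, Φ c ∈ Submodule.span ℝ (Set.range V) := fun c => by
    rw [hΦ, Fintype.linearCombination_apply]
    exact Submodule.sum_mem _ fun i _ =>
      Submodule.smul_mem _ _ (Submodule.subset_span (Set.mem_range_self i))
  set s : Finset (Finset ι) := Finset.univ.filter fun B =>
    Submodule.span ℝ (V '' B) ≠ Submodule.span ℝ (Set.range V) with hs
  have htop : ∀ B ∈ s, (Submodule.span ℝ (V '' (B : Set ι))).comap Φ ≠ ⊤ := by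
    intro B hB htop
    refine (Finset.mem_filter.1 hB).2 (le_antisymm
      (Submodule.span_mono (Set.image_subset_range _ _)) (Submodule.span_le.2 ?_))
    rintro _ ⟨i, rfl⟩
    have : Pi.single i (1 : ℝ) ∈ (Submodule.span ℝ (V '' (B : Set ι))).comap Φ := by
      rw [htop]; trivial
    simpa [hΦ, Fintype.linearCombination_apply_single] using this
  obtain ⟨c, hc⟩ : ∃ c : ι → ℝ, ∀ B ∈ s, c ∉ (Submodule.span ℝ (V '' (B : Set ι))).comap Φ := by
    have := Subspace.biUnion_ne_univ_of_top_notMem (k := ℝ)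
      (s := s.image fun B : Finset ι => (Submodule.span ℝ (V '' (B : Set ι))).comap Φ) (by
        intro h
        obtain ⟨B, hB, h⟩ := Finset.mem_image.1 h
        exact htop B hB h)
    obtain ⟨c, hc⟩ := (Set.ne_univ_iff_exists_notMem _).1 this
    refine ⟨c, fun B hB h => hc ?_⟩
    simp only [Set.mem_iUnion]
    exact ⟨_, Finset.mem_image_of_mem _ hB, h⟩
  -- The generic `c` may have negative entries; a small move from the all-ones vector towards it
  -- keeps the coefficients positive and still leaves every proper subspace.
  have hev : ∀ᶠ ε in 𝓝[>] (0 : ℝ), (∀ i, 0 < 1 + ε * c i) ∧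
      ∀ B ∈ s, (fun _ => (1 : ℝ)) + ε • c ∉ (Submodule.span ℝ (V '' (B : Set ι))).comap Φ := by
    refine Eventually.and (eventually_all.2 fun i => ?_)
      ((Filter.eventually_all_finset s).2 fun B hB => eventually_add_smul_notMem _ (hc B hB) _)
    have hcont : Tendsto (fun ε : ℝ => 1 + ε * c i) (𝓝[>] 0) (𝓝 (1 + 0 * c i)) :=
      ((continuous_const.add (continuous_id.mul continuous_const)).tendsto 0).mono_left
        nhdsWithin_le_nhds
    rw [zero_mul, add_zero] at hcont
    exact hcont.eventually (lt_mem_nhds one_pos)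
  obtain ⟨ε, hpos, hB⟩ := hev.exists
  refine ⟨Φ ((fun _ => (1 : ℝ)) + ε • c), hrange _, ⟨_, fun i => ?_, rfl⟩, fun B hne => ?_⟩
  · simpa using hpos i
  · exact hB B (Finset.mem_filter.2 ⟨Finset.mem_univ _, hne⟩)

theorem convex_openCell (V : ι → E) (B : Finset ι) : Convex ℝ (openCell V B) := by
  rintro u ⟨c, hpos, hzero, rfl⟩ u' ⟨c', hpos', hzero', rfl⟩ s t hs ht hst
  refine ⟨s • c + t • c', fun i hi => ?_, fun i hi => ?_, ?_⟩
  · exact convex_Ioi (0 : ℝ) (hpos i hi) (hpos' i hi) hs ht hst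
  · simp [hzero i hi, hzero' i hi]
  · simp [add_smul, mul_smul, Finset.sum_add_distrib, Finset.smul_sum]

/-- The points which lie in the open cell of `B` after an infinitesimal move towards `g`. -/
def halfOpenCell (V : ι → E) (g : E) (B : Finset ι) : Set E :=
  {u | ∀ᶠ ε in 𝓝[>] (0 : ℝ), u + ε • g ∈ openCell V B}

/-- The cell is convex, so the admissible `ε` form an interval; if it accumulates at `0` from the
right, it contains some `(0, ε₀)`. -/
theorem mem_halfOpenCell_of_frequently {V : ι → E} {g : E} {B : Finset ι} {u : E}
    (h : ∃ᶠ ε in 𝓝[>] (0 : ℝ), u + ε • g ∈ openCell V B) : u ∈ halfOpenCell V g B := by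
  obtain ⟨ε₀, h0, hpos⟩ := (h.and_eventually self_mem_nhdsWithin).exists
  change ∀ᶠ ε in 𝓝[>] (0 : ℝ), u + ε • g ∈ openCell V B
  filter_upwards [Ioo_mem_nhdsGT (show (0 : ℝ) < ε₀ from hpos)] with ε hε
  obtain ⟨ε₁, h1, hlt⟩ := (h.and_eventually (Ioo_mem_nhdsGT hε.1)).exists
  have hconv : Convex ℝ {t : ℝ | u + t • g ∈ openCell V B} := by
    intro s hs t ht a b ha hb hab
    have := convex_openCell V B hs ht ha hb hab
    change u + (a • s + b • t) • g ∈ openCell V B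
    convert this using 1
    simp only [smul_add, add_smul, smul_smul, smul_eq_mul]
    have : u = a • u + b • u := by rw [← add_smul, hab, one_smul]
    nth_rewrite 1 [this]
    abel
  exact hconv.ordConnected.out h1 h0 ⟨hlt.2.le, hε.2.le⟩

variable [LinearOrder ι]

/-- As a positive combination, `g` keeps `u + ε • g` in the cone, and genericity keeps it off all
lower-dimensional cells for small `ε`. Finitely many full-dimensional cells remain, so one of them
is met for arbitrarily small `ε`. -/
theorem exists_mem_halfOpenCell {V : ι → E} {g : E}
    (hpos : ∃ c : ι → ℝ, (∀ i, 0 < c i) ∧ ∑ i, c i • V i = g)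
    (hg : ∀ B : Finset ι, Submodule.span ℝ (V '' B) ≠ Submodule.span ℝ (Set.range V) →
      g ∉ Submodule.span ℝ (V '' B)) {u : E} (hu : u ∈ generatedCone V) :
    ∃ B, IsLexFace V B ∧ Submodule.span ℝ (V '' B) = Submodule.span ℝ (Set.range V) ∧
      u ∈ halfOpenCell V g B := by
  by_contra! hcon
  have h1 : ∀ᶠ ε in 𝓝[>] (0 : ℝ), ∀ B : Finset ι, IsLexFace V B →
      Submodule.span ℝ (V '' B) = Submodule.span ℝ (Set.range V) →
      u + ε • g ∉ openCell V B := by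
    refine eventually_all.2 fun B => ?_
    by_cases hB : IsLexFace V B ∧
      Submodule.span ℝ (V '' B) = Submodule.span ℝ (Set.range V)
    · have := mt mem_halfOpenCell_of_frequently (hcon B hB.1 hB.2)
      rw [not_frequently] at this
      exact this.mono fun ε h _ _ => h
    · exact Eventually.of_forall fun ε h h' => absurd ⟨h, h'⟩ hB
  have h2 : ∀ᶠ ε in 𝓝[>] (0 : ℝ), ∀ B : Finset ι,
      Submodule.span ℝ (V '' B) ≠ Submodule.span ℝ (Set.range V) →
      u + ε • g ∉ Submodule.span ℝ (V '' B) := by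
    refine eventually_all.2 fun B => ?_
    by_cases hB : Submodule.span ℝ (V '' (B : Set ι)) = Submodule.span ℝ (Set.range V)
    · exact Eventually.of_forall fun ε h => absurd hB h
    · exact (eventually_add_smul_notMem _ (hg B hB) u).mono fun ε h _ => h
  obtain ⟨ε, ⟨h1, h2⟩, hε⟩ := ((h1.and h2).and self_mem_nhdsWithin).exists
  have hmem : u + ε • g ∈ generatedCone V := by
    obtain ⟨c, hc, rfl⟩ := hpos
    obtain ⟨c', hc', rfl⟩ := hu
    refine ⟨c' + ε • c, fun i => add_nonneg (hc' i) (mul_nonneg (le_of_lt hε) (hc i).le), ?_⟩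
    simp [add_smul, mul_smul, Finset.sum_add_distrib, Finset.smul_sum]
  obtain ⟨B, hB, hcell⟩ := exists_isLexFace_mem_openCell hmem
  by_cases hspan : Submodule.span ℝ (V '' (B : Set ι)) = Submodule.span ℝ (Set.range V)
  · exact h1 B hB hspan hcell
  · refine h2 B hspan ?_
    obtain ⟨c, -, hzero, hsum⟩ := hcell
    rw [← hsum]
    refine Submodule.sum_mem _ fun i _ => ?_
    by_cases hi : i ∈ B
    · exact Submodule.smul_mem _ _ (Submodule.subset_span ⟨i, hi, rfl⟩)
    · simp [hzero i hi]

theorem IsLexFace.eq_of_mem_halfOpenCell {V : ι → E} {g : E} {B B' : Finset ι}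
    (hB : IsLexFace V B) (hB' : IsLexFace V B') {u : E} (hu : u ∈ halfOpenCell V g B)
    (hu' : u ∈ halfOpenCell V g B') : B = B' := by
  have hu₁ : ∀ᶠ ε in 𝓝[>] (0 : ℝ), u + ε • g ∈ openCell V B := hu
  have hu₂ : ∀ᶠ ε in 𝓝[>] (0 : ℝ), u + ε • g ∈ openCell V B' := hu'
  obtain ⟨ε, h, h'⟩ := (hu₁.and hu₂).exists
  exact hB.eq_of_mem_openCell hB' h h'

end HalfOpenDecomposition

/-! ### Half-open simplicial cones in coordinates -/

section Coordinates

variable {E : Type*} [AddCommGroup E] [Module ℝ E] {ι : Type*} [DecidableEq ι]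

theorem exists_coordinates {V : ι → E} {B : Finset ι} (hB : LinearIndepOn ℝ V (B : Set ι)) :
    ∃ f : E →ₗ[ℝ] (ι → ℝ), ∀ i ∈ B, f (V i) = Pi.single i 1 := by
  obtain ⟨g, hg⟩ := LinearMap.exists_leftInverse_of_injective
    (Finsupp.linearCombination ℝ fun i : (B : Set ι) => V i) (LinearMap.ker_eq_bot.2 hB)
  refine ⟨Finsupp.lcoeFun ∘ₗ Finsupp.lmapDomain ℝ ℝ Subtype.val ∘ₗ g, fun i hi => ?_⟩
  have h := LinearMap.congr_fun hg (Finsupp.single (⟨i, hi⟩ : (B : Set ι)) 1)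
  simp only [LinearMap.comp_apply, Finsupp.linearCombination_single, one_smul,
    LinearMap.id_apply] at h
  simp [h, Finsupp.single_eq_pi_single]

theorem sum_coordinates_smul {V : ι → E} {B : Finset ι} {f : E →ₗ[ℝ] (ι → ℝ)}
    (hf : ∀ i ∈ B, f (V i) = Pi.single i 1) {u : E} (hu : u ∈ Submodule.span ℝ (V '' B)) :
    ∑ i ∈ B, f u i • V i = u := by
  induction hu using Submodule.span_induction with
  | mem x hx =>
    obtain ⟨j, hj, rfl⟩ := hx
    rw [hf j hj, Finset.sum_eq_single_of_mem j hj]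
    · simp
    · intro i _ hij
      simp [hij]
  | zero => simp
  | add x y _ _ hx hy => simp [add_smul, Finset.sum_add_distrib, hx, hy]
  | smul a x _ hx => simp [mul_smul, ← Finset.smul_sum, hx]

theorem coordinates_sum_smul [Fintype ι] {V : ι → E} {B : Finset ι} {f : E →ₗ[ℝ] (ι → ℝ)}
    (hf : ∀ i ∈ B, f (V i) = Pi.single i 1) {c : ι → ℝ} (hc : ∀ i ∉ B, c i = 0) :
    f (∑ i, c i • V i) = c := by
  rw [map_sum]
  have : ∀ i ∈ Finset.univ, f (c i • V i) = Pi.single i (c i) := by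
    intro i _
    by_cases hi : i ∈ B
    · rw [map_smul, hf i hi, ← Pi.single_smul]
      simp
    · simp [hc i hi]
  rw [Finset.sum_congr rfl this, Finset.univ_sum_single]

theorem mem_openCell_iff [Fintype ι] {V : ι → E} {B : Finset ι} {f : E →ₗ[ℝ] (ι → ℝ)}
    (hf : ∀ i ∈ B, f (V i) = Pi.single i 1) {u : E} :
    u ∈ openCell V B ↔ u ∈ Submodule.span ℝ (V '' B) ∧ ∀ i ∈ B, 0 < f u i := by
  constructor
  · rintro ⟨c, hpos, hzero, rfl⟩
    refine ⟨Submodule.sum_mem _ fun i _ => ?_, fun i hi => ?_⟩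
    · by_cases hi : i ∈ B
      · exact Submodule.smul_mem _ _ (Submodule.subset_span ⟨i, hi, rfl⟩)
      · simp [hzero i hi]
    · rw [coordinates_sum_smul hf hzero]
      exact hpos i hi
  · rintro ⟨hu, hpos⟩
    refine ⟨fun i => if i ∈ B then f u i else 0, fun i hi => ?_, fun i hi => ?_, ?_⟩
    · simpa [hi] using hpos i hi
    · simp [hi]
    · simp only [ite_smul, zero_smul, ← Finset.sum_filter]
      simpa using sum_coordinates_smul hf hu

/-- This decides which facets belong to a half-open cell: a facet is included exactly when `g`
points strictly inward across it. -/
theorem eventually_pos_add_mul_iff (x y : ℝ) :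
    (∀ᶠ ε in 𝓝[>] (0 : ℝ), 0 < x + ε * y) ↔
      x ∈ if 0 < y then Set.Ici (0 : ℝ) else Set.Ioi 0 := by
  have hcont : Tendsto (fun ε : ℝ => x + ε * y) (𝓝[>] 0) (𝓝 (x + 0 * y)) :=
    ((continuous_const.add (continuous_id.mul continuous_const)).tendsto 0).mono_left
      nhdsWithin_le_nhds
  rw [zero_mul, add_zero] at hcont
  constructor
  · intro h
    split_ifs with hy
    · exact ge_of_tendsto hcont (h.mono fun _ h => h.le)
    · obtain ⟨ε, h, hε⟩ := (h.and self_mem_nhdsWithin).exists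
      have : ε * y ≤ 0 := mul_nonpos_of_nonneg_of_nonpos (le_of_lt hε) (not_lt.1 hy)
      exact Set.mem_Ioi.2 (by linarith)
  · split_ifs with hy
    · intro hx
      filter_upwards [self_mem_nhdsWithin] with ε hε
      exact add_pos_of_nonneg_of_pos hx (mul_pos hε hy)
    · intro hx
      exact hcont.eventually (lt_mem_nhds hx)

theorem mem_halfOpenCell_iff [Fintype ι] {V : ι → E} {B : Finset ι} {f : E →ₗ[ℝ] (ι → ℝ)}
    (hf : ∀ i ∈ B, f (V i) = Pi.single i 1) {g : E} (hg : g ∈ Submodule.span ℝ (V '' B))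
    {u : E} :
    u ∈ halfOpenCell V g B ↔ u ∈ Submodule.span ℝ (V '' B) ∧
      ∀ i ∈ B, f u i ∈ if 0 < f g i then Set.Ici (0 : ℝ) else Set.Ioi 0 := by
  have hW : ∀ ε : ℝ, u + ε • g ∈ Submodule.span ℝ (V '' (B : Set ι)) ↔
      u ∈ Submodule.span ℝ (V '' (B : Set ι)) :=
    fun ε => Submodule.add_mem_iff_left _ (Submodule.smul_mem _ _ hg)
  change (∀ᶠ ε in 𝓝[>] (0 : ℝ), u + ε • g ∈ openCell V B) ↔ _
  simp only [mem_openCell_iff hf, hW, ← eventually_pos_add_mul_iff]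
  rw [eventually_and, eventually_const, Filter.eventually_all_finset]
  simp

variable [Fintype ι]

/-- The lattice points of a shifted half-open simplicial cone. -/
theorem isNonnegPolynomial_simplicialCone (ht : E →ₗ[ℝ] ℝ) (L : AddSubgroup E) {V : ι → E}
    {B : Finset ι} {q : ℕ} (hVL : ∀ i, V i ∈ L) (hVq : ∀ i, ht (V i) = q)
    {f : E →ₗ[ℝ] (ι → ℝ)} (hf : ∀ i ∈ B, f (V i) = Pi.single i 1)
    {I : ι → Set ℝ} (hI : ∀ i, I i = Set.Ici 0 ∨ I i = Set.Ioi 0) {a : E} (ha : 0 ≤ ht a)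
    (hfin : LevelFinite ht {u | u ∈ L ∧ u - a ∈ generatedCone V}) :
    IsNonnegPolynomial ((1 - PowerSeries.X ^ q) ^ B.card * levelSeries ht
      {u | u ∈ L ∧ u - a ∈ Submodule.span ℝ (V '' B) ∧ ∀ i ∈ B, f (u - a) i ∈ I i}) := by
  have hInn : ∀ i x, x ∈ I i → 0 ≤ x := by
    intro i x hx
    rcases hI i with h | h <;> rw [h] at hx
    · exact hx
    · exact le_of_lt hx
  have hIadd : ∀ i x, x ∈ I i → x + 1 ∈ I i := by
    intro i x hx
    have := hInn i x hx
    rcases hI i with h | h <;> rw [h]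
    · exact Set.mem_Ici.2 (by linarith)
    · exact Set.mem_Ioi.2 (by linarith)
  have hIle : ∀ i x, x - 1 ∉ I i → x ≤ 1 := by
    intro i x hx
    by_contra hlt
    rcases hI i with h | h <;> rw [h] at hx <;> apply hx
    · exact Set.mem_Ici.2 (by linarith)
    · exact Set.mem_Ioi.2 (by linarith)
  -- `S T` keeps the points from which no `V i` with `i ∈ T` can be subtracted. It interpolates
  -- between the whole half-open cone (`T = ∅`) and its fundamental parallelepiped (`T = B`), each
  -- new index costing one factor `1 - X ^ q`.
  set S : Finset ι → Set E := fun T => {u | u ∈ L ∧ u - a ∈ Submodule.span ℝ (V '' B) ∧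
    (∀ i ∈ B, f (u - a) i ∈ I i) ∧ ∀ i ∈ T, f (u - a) i - 1 ∉ I i} with hS
  have hht : ∀ u : E, u - a ∈ Submodule.span ℝ (V '' (B : Set ι)) →
      ht u = ht a + ∑ i ∈ B, f (u - a) i * q := by
    intro u hu
    have h := congrArg ht (sum_coordinates_smul hf hu)
    simp only [map_sum, map_smul, hVq, smul_eq_mul] at h
    rw [map_sub ht] at h
    linarith
  have hlevel : ∀ T, LevelFinite ht (S T) := by
    refine fun T => hfin.mono fun u hu => ⟨hu.1, fun i => if i ∈ B then f (u - a) i else 0, ?_, ?_⟩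
    · intro i
      change 0 ≤ if i ∈ B then f (u - a) i else 0
      split_ifs with hi
      · exact hInn i _ (hu.2.2.1 i hi)
      · exact le_rfl
    · simp only [ite_smul, zero_smul, ← Finset.sum_filter]
      simpa using sum_coordinates_smul hf hu.2.1
  have hnn : ∀ T, ∀ u ∈ S T, 0 ≤ ht u := by
    intro T u hu
    rw [hht u hu.2.1]
    exact add_nonneg ha (Finset.sum_nonneg fun i hi =>
      mul_nonneg (hInn i _ (hu.2.2.1 i hi)) (Nat.cast_nonneg q))
  have key : ∀ T ⊆ B, (1 - PowerSeries.X ^ q) ^ T.card * levelSeries ht (S ∅) =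
      levelSeries ht (S T) := by
    intro T
    induction T using Finset.induction_on with
    | empty => intro _; simp
    | insert j T hj ih =>
      intro hT
      have hjB : j ∈ B := hT (Finset.mem_insert_self j T)
      rw [Finset.card_insert_of_notMem hj, pow_succ', mul_assoc,
        ih fun i hi => hT (Finset.mem_insert_of_mem hi)]
      have hcoord : ∀ u i, f (u - V j - a) i = f (u - a) i - Pi.single (M := fun _ => ℝ) j 1 i := by
        intro u i
        rw [sub_right_comm, map_sub, hf j hjB, Pi.sub_apply]
      have hcoord' : ∀ u i, f (u + V j - a) i = f (u - a) i + Pi.single (M := fun _ => ℝ) j 1 i := by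
        intro u i
        rw [add_sub_right_comm, map_add, hf j hjB, Pi.add_apply]
      have hVj : V j ∈ Submodule.span ℝ (V '' (B : Set ι)) := Submodule.subset_span ⟨j, hjB, rfl⟩
      rw [one_sub_X_pow_mul_levelSeries ht (hVq j) (hlevel T) (hnn T)]
      · congr 1
        ext u
        simp only [hS, Set.mem_ofPred_eq, Finset.forall_mem_insert]
        constructor
        · rintro ⟨⟨h1, h2, h3, h4⟩, h5⟩
          refine ⟨h1, h2, h3, fun hmem => h5 ⟨L.sub_mem h1 (hVL j), ?_, fun i hi => ?_,
            fun i hi => ?_⟩, h4⟩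
          · rw [sub_right_comm]
            exact Submodule.sub_mem _ h2 hVj
          · rw [hcoord]
            by_cases hij : i = j
            · subst hij; simpa using hmem
            · simpa [hij] using h3 i hi
          · rw [hcoord]
            have hij : i ≠ j := fun h => hj (h ▸ hi)
            simpa [hij] using h4 i hi
        · rintro ⟨h1, h2, h3, h4, h5⟩
          refine ⟨⟨h1, h2, h3, h5⟩, fun h => h4 ?_⟩
          have := h.2.2.1 j hjB
          rw [hcoord] at this
          simpa using this
      · rintro u ⟨h1, h2, h3, h4⟩
        refine ⟨L.add_mem h1 (hVL j), ?_, fun i hi => ?_, fun i hi => ?_⟩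
        · rw [add_sub_right_comm]
          exact Submodule.add_mem _ h2 hVj
        · rw [hcoord']
          by_cases hij : i = j
          · subst hij; simpa using hIadd i _ (h3 i hi)
          · simpa [hij] using h3 i hi
        · rw [hcoord']
          have hij : i ≠ j := fun h => hj (h ▸ hi)
          simpa [hij] using h4 i hi
  have hS0 : {u | u ∈ L ∧ u - a ∈ Submodule.span ℝ (V '' (B : Set ι)) ∧
      ∀ i ∈ B, f (u - a) i ∈ I i} = S ∅ := by
    simp [hS]
  rw [hS0, key B subset_rfl]
  -- In the parallelepiped every coordinate is at most `1`, which bounds the height.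
  refine isNonnegPolynomial_levelSeries ht (ht a + ∑ i ∈ B, 1 * (q : ℝ)) fun u hu => ?_
  rw [hht u hu.2.1]
  refine add_le_add le_rfl (Finset.sum_le_sum fun i hi => ?_)
  exact mul_le_mul_of_nonneg_right (hIle i _ (hu.2.2.2 i hi)) (Nat.cast_nonneg q)

end Coordinates

/-- The lattice points of a shifted cone generated by lattice points of height `q`. -/
theorem isNonnegPolynomial_shiftedCone {E : Type*} [AddCommGroup E] [Module ℝ E] {ι : Type*}
    [Fintype ι] [LinearOrder ι] (ht : E →ₗ[ℝ] ℝ) (L : AddSubgroup E) {V : ι → E} {q : ℕ}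
    (hVL : ∀ i, V i ∈ L) (hVq : ∀ i, ht (V i) = q) {a : E} (ha : 0 ≤ ht a)
    (hfin : LevelFinite ht {u | u ∈ L ∧ u - a ∈ generatedCone V}) :
    IsNonnegPolynomial ((1 - PowerSeries.X ^ q) ^
      Module.finrank ℝ (Submodule.span ℝ (Set.range V)) *
        levelSeries ht {u | u ∈ L ∧ u - a ∈ generatedCone V}) := by
  classical
  obtain ⟨g, hgW, hpos, hg⟩ := exists_generic_combination V
  set faces : Finset (Finset ι) := Finset.univ.filter fun B => IsLexFace V B ∧
    Submodule.span ℝ (V '' B) = Submodule.span ℝ (Set.range V) with hfaces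
  have hmemf : ∀ B ∈ faces, IsLexFace V B ∧
      Submodule.span ℝ (V '' (B : Set ι)) = Submodule.span ℝ (Set.range V) :=
    fun B hB => (Finset.mem_filter.1 hB).2
  set A : Finset ι → Set E := fun B => {u | u ∈ L ∧ u - a ∈ halfOpenCell V g B} with hA
  have hsub : ∀ B ∈ faces, halfOpenCell V g B ⊆ generatedCone V := by
    intro B hB u hu
    obtain ⟨hface, hspan⟩ := hmemf B hB
    obtain ⟨f, hf⟩ := exists_coordinates hface.linearIndepOn
    rw [mem_halfOpenCell_iff hf (hspan ▸ hgW)] at hu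
    refine ⟨fun i => if i ∈ B then f u i else 0, fun i => ?_, ?_⟩
    · dsimp only
      split_ifs with hi
      · have := hu.2 i hi
        split_ifs at this
        · exact this
        · exact le_of_lt this
      · exact le_rfl
    · simp only [ite_smul, zero_smul, ← Finset.sum_filter]
      simpa using sum_coordinates_smul hf hu.1
  have hfinA : ∀ B ∈ faces, LevelFinite ht (A B) := fun B hB =>
    hfin.mono fun u hu => ⟨hu.1, hsub B hB hu.2⟩
  have hunion : {u | u ∈ L ∧ u - a ∈ generatedCone V} = ⋃ B ∈ faces, A B := by
    ext u
    simp only [Set.mem_iUnion]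
    constructor
    · rintro ⟨h1, h2⟩
      obtain ⟨B, hB1, hB2, hB3⟩ := exists_mem_halfOpenCell hpos hg h2
      exact ⟨B, Finset.mem_filter.2 ⟨Finset.mem_univ _, hB1, hB2⟩, h1, hB3⟩
    · rintro ⟨B, hB, h1, h2⟩
      exact ⟨h1, hsub B hB h2⟩
  rw [hunion, levelSeries_biUnion ht faces A hfinA, Finset.mul_sum]
  · refine IsNonnegPolynomial.sum _ _ fun B hB => ?_
    obtain ⟨hface, hspan⟩ := hmemf B hB
    have hli := hface.linearIndepOn
    obtain ⟨f, hf⟩ := exists_coordinates hli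
    -- Only full-dimensional faces occur, so the same exponent serves all cells.
    have hcard : Module.finrank ℝ (Submodule.span ℝ (Set.range V)) = B.card := by
      rw [← hspan, Set.image_eq_range]
      have := finrank_span_eq_card hli
      simpa using this
    have hcell := isNonnegPolynomial_simplicialCone ht L hVL hVq hf
      (I := fun i => if 0 < f g i then Set.Ici (0 : ℝ) else Set.Ioi 0)
      (fun i => by split_ifs <;> simp) ha hfin
    rw [hcard]
    simpa only [hA, mem_halfOpenCell_iff hf (hspan ▸ hgW : g ∈ _)] using hcell
  · intro B hB B' hB' hne
    rw [Set.disjoint_left]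
    exact fun u hu hu' => hne ((hmemf B hB).1.eq_of_mem_halfOpenCell (hmemf B' hB').1 hu.2 hu'.2)

/-! ### The apex coordinate -/

section GeneratedCone

variable {E : Type*} [AddCommGroup E] [Module ℝ E] {ι : Type*} [Fintype ι] {V : ι → E}

theorem generatedCone_subset_span (V : ι → E) :
    generatedCone V ⊆ Submodule.span ℝ (Set.range V) := by
  rintro u ⟨c, -, rfl⟩
  exact Submodule.sum_mem _ fun i _ =>
    Submodule.smul_mem _ _ (Submodule.subset_span (Set.mem_range_self i))

theorem zero_mem_generatedCone (V : ι → E) : (0 : E) ∈ generatedCone V :=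
  ⟨0, fun _ => le_rfl, by simp⟩

/-- A functional vanishing on the span of the base and equal to `1` at `x` reads off `t`, so
different translates of the base cone are disjoint. -/
theorem exists_apexCoordinate {x : E} (hx : x ∉ Submodule.span ℝ (Set.range V)) :
    ∃ φ : E →ₗ[ℝ] ℝ, ∀ (u : E) (t : ℝ), u - t • x ∈ generatedCone V → φ u = t := by
  obtain ⟨f, hfx, hf⟩ := Submodule.exists_le_ker_of_notMem hx
  refine ⟨(f x)⁻¹ • f, fun u t hu => ?_⟩
  have h := LinearMap.mem_ker.1 (hf (generatedCone_subset_span V hu))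
  rw [map_sub, map_smul, sub_eq_zero] at h
  rw [LinearMap.smul_apply, h, smul_eq_mul, smul_eq_mul]
  field_simp

end GeneratedCone

/-! ### Slicing the cone over a pyramid into translates -/

section ConeOverPyramid

variable {E : Type*} [NormedAddCommGroup E] [NormedSpace ℝ E] {ι : Type*} [Fintype ι]

theorem norm_le_of_sub_mem_generatedCone (ht : E →ₗ[ℝ] ℝ) {V : ι → E} {q : ℕ} (hq : 0 < q)
    (hVq : ∀ i, ht (V i) = q) {a u : E} (hu : u - a ∈ generatedCone V) :
    0 ≤ ht u - ht a ∧ ‖u‖ ≤ ‖a‖ + ∑ i, (ht u - ht a) / q * ‖V i‖ := by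
  obtain ⟨c, hc, hcu⟩ := hu
  have hq' : (0 : ℝ) < q := Nat.cast_pos.2 hq
  have hsum : (∑ i, c i) * q = ht u - ht a := by
    rw [← map_sub, ← hcu, map_sum, Finset.sum_mul]
    simp [hVq]
  refine ⟨hsum ▸ mul_nonneg (Finset.sum_nonneg fun i _ => hc i) hq'.le, ?_⟩
  have hu' : u = a + ∑ i, c i • V i := by rw [hcu]; abel
  calc ‖u‖ = ‖a + ∑ i, c i • V i‖ := by rw [← hu']
    _ ≤ ‖a‖ + ∑ i, ‖c i • V i‖ := (norm_add_le _ _).trans (by gcongr; exact norm_sum_le _ _)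
    _ ≤ _ := by
      gcongr with i
      rw [norm_smul, Real.norm_of_nonneg (hc i)]
      gcongr
      rw [le_div_iff₀ hq', ← hsum]
      gcongr
      exact Finset.single_le_sum (fun j _ => hc j) (Finset.mem_univ i)

variable {ht : E →ₗ[ℝ] ℝ} {L : AddSubgroup E} {V : ι → E} {q : ℕ}

theorem levelFinite_shiftedCone (hL : ∀ R : ℝ, {u | u ∈ L ∧ ‖u‖ ≤ R}.Finite) (hq : 0 < q)
    (hVq : ∀ i, ht (V i) = q) (a : E) :
    LevelFinite ht {u | u ∈ L ∧ u - a ∈ generatedCone V} := by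
  intro k
  refine (hL (‖a‖ + ∑ i, (k - ht a) / q * ‖V i‖)).subset ?_
  rintro u ⟨⟨h1, h2⟩, hk⟩
  rw [← hk]
  exact ⟨h1, (norm_le_of_sub_mem_generatedCone ht hq hVq h2).2⟩

theorem levelFinite_pyramid (hL : ∀ R : ℝ, {u | u ∈ L ∧ ‖u‖ ≤ R}.Finite) (hq : 0 < q)
    (hVq : ∀ i, ht (V i) = q) {x : E} (hx : ht x = 1) :
    LevelFinite ht {u | u ∈ L ∧ ∃ t : ℝ, 0 ≤ t ∧ u - t • x ∈ generatedCone V} := by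
  intro k
  refine (hL (k * ‖x‖ + ∑ i, (k : ℝ) / q * ‖V i‖)).subset ?_
  rintro u ⟨⟨h1, t, ht0, h2⟩, hk⟩
  obtain ⟨h3, h4⟩ := norm_le_of_sub_mem_generatedCone ht hq hVq h2
  rw [map_smul, hx, smul_eq_mul, mul_one, hk] at h3 h4
  refine ⟨h1, h4.trans ?_⟩
  rw [norm_smul, Real.norm_of_nonneg ht0]
  gcongr <;> linarith

/-- Only finitely many translates of the cone over the base, below the generator at the apex,
contain lattice points. -/
theorem finite_setOf_translate (hL : ∀ R : ℝ, {u | u ∈ L ∧ ‖u‖ ≤ R}.Finite)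
    (hVL : ∀ i, V i ∈ L) {x : E} (hx : x ∉ Submodule.span ℝ (Set.range V)) (r : ℝ) :
    {t : ℝ | (0 ≤ t ∧ t < r) ∧ ∃ u ∈ L, u - t • x ∈ generatedCone V}.Finite := by
  obtain ⟨φ, hφ⟩ := exists_apexCoordinate hx
  refine ((hL (r * ‖x‖ + ∑ i, ‖V i‖)).image φ).subset ?_
  rintro t ⟨⟨h0, h1⟩, u, hu, c, hc, hcu⟩
  -- Removing integer parts stays in `L`, does not change `t`, and lands in a fixed ball; thus `φ`
  -- maps a finite set of lattice points onto all possible `t`.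
  have hu' : u - ∑ i, ⌊c i⌋ • V i = t • x + ∑ i, Int.fract (c i) • V i := by
    have : u = t • x + ∑ i, c i • V i := by rw [hcu]; abel
    rw [this, add_sub_assoc, ← Finset.sum_sub_distrib]
    congr 1
    refine Finset.sum_congr rfl fun i _ => ?_
    rw [← Int.self_sub_floor, sub_smul, Int.cast_smul_eq_zsmul]
  refine ⟨u - ∑ i, ⌊c i⌋ • V i, ⟨?_, ?_⟩, hφ _ t ?_⟩
  · exact L.sub_mem hu (L.sum_mem fun i _ => L.zsmul_mem (hVL i) _)
  · rw [hu']
    refine (norm_add_le _ _).trans (add_le_add ?_ ((norm_sum_le _ _).trans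
      (Finset.sum_le_sum fun i _ => ?_)))
    · rw [norm_smul, Real.norm_of_nonneg h0]
      gcongr
    · rw [norm_smul, Real.norm_of_nonneg (Int.fract_nonneg _)]
      exact mul_le_of_le_one_left (norm_nonneg _) (Int.fract_lt_one _).le
  · rw [hu']
    exact ⟨fun i => Int.fract (c i), fun i => Int.fract_nonneg _, by abel⟩

theorem one_sub_X_pow_mul_levelSeries_pyramid (hL : ∀ R : ℝ, {u | u ∈ L ∧ ‖u‖ ≤ R}.Finite)
    (hq : 0 < q) (hVL : ∀ i, V i ∈ L) (hVq : ∀ i, ht (V i) = q) {x : E} (hx1 : ht x = 1)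
    (hx : x ∉ Submodule.span ℝ (Set.range V)) {r : ℕ} (hrx : (r : ℝ) • x ∈ L) :
    (1 - PowerSeries.X ^ r) *
        levelSeries ht {u | u ∈ L ∧ ∃ t : ℝ, 0 ≤ t ∧ u - t • x ∈ generatedCone V} =
      ∑ t ∈ (finite_setOf_translate hL hVL hx r).toFinset,
        levelSeries ht {u | u ∈ L ∧ u - t • x ∈ generatedCone V} := by
  obtain ⟨φ, hφ⟩ := exists_apexCoordinate hx
  rw [one_sub_X_pow_mul_levelSeries ht (b := (r : ℝ) • x) (by simp [hx1])
    (levelFinite_pyramid hL hq hVq hx1),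
    ← levelSeries_biUnion ht _ _ fun t _ => levelFinite_shiftedCone hL hq hVq _]
  · congr 1
    ext u
    simp only [Set.mem_ofPred_eq, Set.mem_iUnion, Set.Finite.mem_toFinset]
    constructor
    · rintro ⟨⟨h1, t, h2, h3⟩, h4⟩
      refine ⟨t, ⟨⟨h2, ?_⟩, u, h1, h3⟩, h1, h3⟩
      -- If `t ≥ r`, then `u - r • x` would still lie in the pyramid cone, with apex coordinate `t -
      -- r`.
      by_contra hlt
      refine h4 ⟨L.sub_mem h1 hrx, t - r, sub_nonneg.2 (not_lt.1 hlt), ?_⟩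
      rwa [sub_smul, sub_sub_sub_cancel_right]
    · rintro ⟨t, ⟨⟨h1, h2⟩, -⟩, h3, h4⟩
      refine ⟨⟨h3, t, h1, h4⟩, ?_⟩
      rintro ⟨-, t', h5, h6⟩
      rw [sub_sub, ← add_smul] at h6
      have := hφ _ _ h6
      have := hφ _ _ h4
      linarith
  · intro t _ t' _ hne
    rw [Set.disjoint_left]
    exact fun u hu hu' => hne ((hφ _ _ hu.2).symm.trans (hφ _ _ hu'.2))
  · rintro u ⟨-, t, h1, h2⟩
    have := (norm_le_of_sub_mem_generatedCone ht hq hVq h2).1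
    rw [map_smul, hx1, smul_eq_mul, mul_one] at this
    linarith
  · rintro u ⟨h1, t, h2, h3⟩
    refine ⟨L.add_mem h1 hrx, t + r, add_nonneg h2 (Nat.cast_nonneg r), ?_⟩
    rwa [add_smul, add_sub_add_right_eq_sub]

theorem isNonnegPolynomial_levelSeries_pyramid_sub [LinearOrder ι]
    (hL : ∀ R : ℝ, {u | u ∈ L ∧ ‖u‖ ≤ R}.Finite)
    (hq : 0 < q) (hVL : ∀ i, V i ∈ L) (hVq : ∀ i, ht (V i) = q) {x : E} (hx1 : ht x = 1)
    (hx : x ∉ Submodule.span ℝ (Set.range V)) {r : ℕ} (hr : 0 < r) (hrx : (r : ℝ) • x ∈ L) :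
    IsNonnegPolynomial ((1 - PowerSeries.X ^ q) ^
        Module.finrank ℝ (Submodule.span ℝ (Set.range V)) * (1 - PowerSeries.X ^ r) *
          levelSeries ht {u | u ∈ L ∧ ∃ t : ℝ, 0 ≤ t ∧ u - t • x ∈ generatedCone V} -
      (1 - PowerSeries.X ^ q) ^ Module.finrank ℝ (Submodule.span ℝ (Set.range V)) *
          levelSeries ht {u | u ∈ L ∧ u ∈ generatedCone V}) := by
  have hmem0 : (0 : ℝ) ∈ (finite_setOf_translate hL hVL hx r).toFinset := by
    rw [Set.Finite.mem_toFinset]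
    exact ⟨⟨le_rfl, Nat.cast_pos.2 hr⟩, 0, L.zero_mem, by simpa using zero_mem_generatedCone V⟩
  rw [mul_assoc, one_sub_X_pow_mul_levelSeries_pyramid hL hq hVL hVq hx1 hx hrx,
    ← Finset.add_sum_erase _ _ hmem0, mul_add]
  simp only [zero_smul, sub_zero, add_sub_cancel_left]
  rw [Finset.mul_sum]
  refine IsNonnegPolynomial.sum _ _ fun t ht' => ?_
  refine isNonnegPolynomial_shiftedCone ht L hVL hVq ?_ (levelFinite_shiftedCone hL hq hVq _)
  rw [map_smul, hx1, smul_eq_mul, mul_one]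
  exact ((Set.Finite.mem_toFinset _).1 (Finset.mem_of_mem_erase ht')).1.1

theorem isNonnegPolynomial_levelSeries_generatedCone [LinearOrder ι]
    (hL : ∀ R : ℝ, {u | u ∈ L ∧ ‖u‖ ≤ R}.Finite)
    (hq : 0 < q) (hVL : ∀ i, V i ∈ L) (hVq : ∀ i, ht (V i) = q) :
    IsNonnegPolynomial ((1 - PowerSeries.X ^ q) ^
      Module.finrank ℝ (Submodule.span ℝ (Set.range V)) *
        levelSeries ht {u | u ∈ L ∧ u ∈ generatedCone V}) := by
  have h := isNonnegPolynomial_shiftedCone ht L hVL hVq (a := 0) (map_zero ht).ge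
    (levelFinite_shiftedCone hL hq hVq 0)
  simpa only [sub_zero] using h

/-- If the translates of the cone strictly below the apex contain no lattice points, then the
pyramid has the same numerator as its base. -/
theorem one_sub_X_pow_mul_levelSeries_pyramid_eq
    (hL : ∀ R : ℝ, {u | u ∈ L ∧ ‖u‖ ≤ R}.Finite)
    (hq : 0 < q) (hVL : ∀ i, V i ∈ L) (hVq : ∀ i, ht (V i) = q) {x : E} (hx1 : ht x = 1)
    (hx : x ∉ Submodule.span ℝ (Set.range V)) {r : ℕ} (hr : 0 < r) (hrx : (r : ℝ) • x ∈ L)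
    (h0 : ∀ t : ℝ, 0 ≤ t → t < r → ∀ u ∈ L, u - t • x ∈ generatedCone V → t = 0) :
    (1 - PowerSeries.X ^ r) *
        levelSeries ht {u | u ∈ L ∧ ∃ t : ℝ, 0 ≤ t ∧ u - t • x ∈ generatedCone V} =
      levelSeries ht {u | u ∈ L ∧ u ∈ generatedCone V} := by
  have hT : (finite_setOf_translate hL hVL hx r).toFinset = {0} := by
    ext t
    rw [Set.Finite.mem_toFinset, Finset.mem_singleton]
    constructor
    · rintro ⟨⟨ht0, ht1⟩, u, hu, hmem⟩
      exact h0 t ht0 ht1 u hu hmem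
    · rintro rfl
      exact ⟨⟨le_rfl, Nat.cast_pos.2 hr⟩, 0, L.zero_mem, by
        simpa using zero_mem_generatedCone V⟩
  rw [one_sub_X_pow_mul_levelSeries_pyramid hL hq hVL hVq hx1 hx hrx, hT, Finset.sum_singleton]
  simp only [zero_smul, sub_zero]

end ConeOverPyramid

/-! ### The integer lattice in the homogenised space -/

section IntegralLattice

variable {κ : Type*}

/-- The lattice of integral points of `ℝ^κ × ℝ`. -/
def integralLattice (κ : Type*) : AddSubgroup ((κ → ℝ) × ℝ) where
  carrier := {u | IsIntegralPoint u.1 ∧ ∃ a : ℤ, u.2 = a}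
  zero_mem' := ⟨fun _ => ⟨0, by simp⟩, 0, by simp⟩
  add_mem' := by
    rintro u v ⟨hu, a, ha⟩ ⟨hv, b, hb⟩
    refine ⟨fun i => ?_, a + b, by simp [ha, hb]⟩
    obtain ⟨c, hc⟩ := hu i
    obtain ⟨d, hd⟩ := hv i
    exact ⟨c + d, by simp [hc, hd]⟩
  neg_mem' := by
    rintro u ⟨hu, a, ha⟩
    refine ⟨fun i => ?_, -a, by simp [ha]⟩
    obtain ⟨c, hc⟩ := hu i
    exact ⟨-c, by simp [hc]⟩

theorem mem_integralLattice {u : (κ → ℝ) × ℝ} :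
    u ∈ integralLattice κ ↔ IsIntegralPoint u.1 ∧ ∃ a : ℤ, u.2 = a := Iff.rfl

variable [Fintype κ]

theorem finite_integralLattice_norm_le (R : ℝ) :
    {u | u ∈ integralLattice κ ∧ ‖u‖ ≤ R}.Finite := by
  classical
  have hfin : ((Set.Icc (fun _ => -⌈R⌉) (fun _ => ⌈R⌉) : Set (κ → ℤ)) ×ˢ
      (Set.Icc (-⌈R⌉) ⌈R⌉ : Set ℤ)).Finite := (Set.finite_Icc _ _).prod (Set.finite_Icc _ _)
  have hbound : ∀ a : ℤ, ‖(a : ℝ)‖ ≤ R → -⌈R⌉ ≤ a ∧ a ≤ ⌈R⌉ := by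
    intro a ha
    rw [Real.norm_eq_abs] at ha
    have := (ha.trans (Int.le_ceil R))
    exact abs_le.1 (by exact_mod_cast this)
  refine (hfin.image fun z => ((fun i => (z.1 i : ℝ), (z.2 : ℝ)) : (κ → ℝ) × ℝ)).subset ?_
  rintro ⟨v, s⟩ ⟨⟨hv, a, ha⟩, hR⟩
  choose z hz using hv
  obtain ⟨hR1, hR2⟩ := norm_prod_le_iff.1 hR
  refine ⟨(z, a), ⟨⟨fun i => ?_, fun i => ?_⟩, hbound a ?_⟩, ?_⟩
  · exact (hbound (z i) ((hz i) ▸ (norm_le_pi_norm v i).trans hR1)).1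
  · exact (hbound (z i) ((hz i) ▸ (norm_le_pi_norm v i).trans hR1)).2
  · exact ha ▸ hR2
  · exact Prod.ext (funext fun i => (hz i).symm) ha.symm

end IntegralLattice

/-! ### Cones over polytopes and Ehrhart series -/

section ConeOverPolytope

variable {κ : Type*} {Q : Set (κ → ℝ)} {q : ℕ} {N : ℕ} {v : Fin N → κ → ℝ}

theorem mem_generatedCone_iff (hne : Q.Nonempty) (hq : 0 < q)
    (hQ : (q : ℝ) • Q = convexHull ℝ (Set.range v)) {y : κ → ℝ} {s : ℝ} :
    (y, s) ∈ generatedCone (fun i => (v i, (q : ℝ))) ↔ 0 ≤ s ∧ y ∈ s • Q := by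
  have hq' : (0 : ℝ) < q := Nat.cast_pos.2 hq
  have hsum : ∀ c : Fin N → ℝ, ∑ i, c i • ((v i, (q : ℝ)) : (κ → ℝ) × ℝ) =
      (∑ i, c i • v i, (∑ i, c i) * q) := by
    intro c
    ext
    · simp [Prod.fst_sum]
    · simp [Prod.snd_sum, Finset.sum_mul]
  constructor
  · rintro ⟨c, hc, hcy⟩
    rw [hsum, Prod.mk.injEq] at hcy
    obtain ⟨rfl, rfl⟩ := hcy
    have hnn : 0 ≤ ∑ i, c i := Finset.sum_nonneg fun i _ => hc i
    refine ⟨mul_nonneg hnn hq'.le, ?_⟩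
    rcases hnn.eq_or_lt with h0 | hpos
    · have hc0 : ∀ i, c i = 0 := fun i =>
        (Finset.sum_eq_zero_iff_of_nonneg fun i _ => hc i).1 h0.symm i (Finset.mem_univ i)
      rw [← h0, zero_mul, Set.zero_smul_set hne]
      simp [hc0]
    · rw [mul_smul, hQ]
      refine ⟨Finset.univ.centerMass c v, ?_, ?_⟩
      · exact Finset.centerMass_mem_convexHull _ (fun i _ => hc i) hpos
          fun i _ => Set.mem_range_self i
      · simp [Finset.centerMass, smul_smul, hpos.ne']
  · rintro ⟨hs, p, hp, rfl⟩
    have hmem : (q : ℝ) • p ∈ convexHull ℝ (Set.range v) := hQ ▸ Set.smul_mem_smul_set hp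
    rw [convexHull_range_eq_exists_affineCombination] at hmem
    obtain ⟨S, w, hw, hw1, hwp⟩ := hmem
    rw [Finset.affineCombination_eq_linear_combination _ _ _ hw1] at hwp
    refine ⟨fun i => if i ∈ S then s / q * w i else 0, fun i => ?_, ?_⟩
    · dsimp only
      split_ifs with hi
      · exact mul_nonneg (div_nonneg hs hq'.le) (hw i hi)
      · exact le_rfl
    · rw [hsum]
      ext1
      · simp only [ite_smul, zero_smul, ← Finset.sum_filter]
        simp only [Finset.filter_mem_eq_inter, Finset.univ_inter, mul_smul, ← Finset.smul_sum,
          hwp]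
        rw [smul_smul, div_mul_cancel₀ _ hq'.ne']
      · rw [← Finset.sum_filter]
        simp only [Finset.filter_mem_eq_inter, Finset.univ_inter, ← Finset.mul_sum, hw1]
        field_simp

/-- The conventional constant term `1` is the true count, since `0 • Q = {0}` for nonempty `Q`. -/
theorem ehrhartSeries_eq_mk (hne : Q.Nonempty) :
    ehrhartSeries Q = PowerSeries.mk fun k => (ehrhartCount Q k : ℤ) := by
  ext k
  simp only [ehrhartSeries, PowerSeries.coeff_mk]
  split_ifs with h
  · subst h
    have : {v : κ → ℝ | v ∈ ((0 : ℕ) : ℝ) • Q ∧ IsIntegralPoint v} = {0} := by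
      ext v
      simp only [Nat.cast_zero, Set.zero_smul_set hne, Set.mem_ofPred_eq, Set.mem_singleton_iff,
        Set.mem_zero, and_iff_left_iff_imp]
      rintro rfl
      exact fun i => ⟨0, by simp⟩
    rw [ehrhartCount, this, Set.ncard_singleton, Nat.cast_one]
  · rfl

theorem levelSeries_eq_ehrhartSeries (hne : Q.Nonempty) {S : Set ((κ → ℝ) × ℝ)}
    (hS : ∀ (y : κ → ℝ) (k : ℕ), (y, (k : ℝ)) ∈ S ↔ IsIntegralPoint y ∧ y ∈ (k : ℝ) • Q) :
    levelSeries (LinearMap.snd ℝ (κ → ℝ) ℝ) S = ehrhartSeries Q := by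
  rw [ehrhartSeries_eq_mk hne]
  ext k
  simp only [levelSeries, PowerSeries.coeff_mk, ehrhartCount, Nat.cast_inj]
  rw [← Set.ncard_image_of_injective {y | y ∈ (k : ℝ) • Q ∧ IsIntegralPoint y}
    (Prod.mk_left_injective (k : ℝ))]
  congr 1
  ext ⟨y, s⟩
  simp only [Set.mem_ofPred_eq, LinearMap.snd_apply, Set.mem_image, Prod.mk.injEq]
  constructor
  · rintro ⟨h1, rfl⟩
    exact ⟨y, ((hS y k).1 h1).symm, rfl, rfl⟩
  · rintro ⟨y, h, rfl, rfl⟩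
    exact ⟨(hS y k).2 h.symm, rfl⟩

theorem levelSeries_generatedCone (hne : Q.Nonempty) (hq : 0 < q)
    (hQ : (q : ℝ) • Q = convexHull ℝ (Set.range v)) :
    levelSeries (LinearMap.snd ℝ (κ → ℝ) ℝ) {u | u ∈ integralLattice κ ∧
      u ∈ generatedCone (fun i => (v i, (q : ℝ)))} = ehrhartSeries Q := by
  refine levelSeries_eq_ehrhartSeries hne fun y k => ?_
  rw [Set.mem_ofPred_eq, mem_generatedCone_iff hne hq hQ, mem_integralLattice]
  have : ∃ a : ℤ, ((k : ℕ) : ℝ) = a := ⟨k, by simp⟩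
  simp [this]

theorem mem_smul_convexHull_insert_iff (hne : Q.Nonempty) (hconv : Convex ℝ Q) {x y : κ → ℝ}
    {k : ℝ} (hk : 0 ≤ k) :
    y ∈ k • convexHull ℝ (insert x Q) ↔
      ∃ t : ℝ, 0 ≤ t ∧ 0 ≤ k - t ∧ y - t • x ∈ (k - t) • Q := by
  rw [convexHull_insert hne, hconv.convexHull_eq, convexJoin_singleton_left]
  constructor
  · rintro ⟨p, hp, rfl⟩
    simp only [Set.mem_iUnion] at hp
    obtain ⟨z, hz, a, b, ha, hb, hab, rfl⟩ := hp
    have hkb : k - k * a = k * b := by linear_combination -k * hab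
    refine ⟨k * a, mul_nonneg hk ha, hkb ▸ mul_nonneg hk hb, z, hz, ?_⟩
    simp only [hkb, smul_add, smul_smul]
    abel
  · rintro ⟨t, ht, htk, z, hz, hzy⟩
    have hy : y = t • x + (k - t) • z := by
      simp only at hzy
      rw [hzy]; abel
    rcases hk.eq_or_lt with h0 | hpos
    · subst h0
      have ht0 : t = 0 := by linarith
      refine ⟨z, ?_, by simp [hy, ht0]⟩
      simp only [Set.mem_iUnion]
      exact ⟨z, hz, right_mem_segment ℝ x z⟩
    · refine ⟨(t / k) • x + ((k - t) / k) • z, ?_, ?_⟩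
      · simp only [Set.mem_iUnion]
        refine ⟨z, hz, t / k, (k - t) / k, div_nonneg ht hpos.le, div_nonneg htk hpos.le, ?_, rfl⟩
        field_simp
        ring
      · simp only [smul_add, smul_smul, hy]
        rw [mul_div_cancel₀ _ hpos.ne', mul_div_cancel₀ _ hpos.ne']

theorem levelSeries_pyramid (hne : Q.Nonempty) (hconv : Convex ℝ Q) (hq : 0 < q)
    (hQ : (q : ℝ) • Q = convexHull ℝ (Set.range v)) (x : κ → ℝ) :
    levelSeries (LinearMap.snd ℝ (κ → ℝ) ℝ) {u | u ∈ integralLattice κ ∧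
      ∃ t : ℝ, 0 ≤ t ∧ u - t • ((x, 1) : (κ → ℝ) × ℝ) ∈
        generatedCone (fun i => (v i, (q : ℝ)))} =
      ehrhartSeries (convexHull ℝ (insert x Q)) := by
  refine levelSeries_eq_ehrhartSeries
    ((Set.insert_nonempty x Q).mono (subset_convexHull ℝ _)) fun y k => ?_
  rw [Set.mem_ofPred_eq, mem_integralLattice,
    mem_smul_convexHull_insert_iff hne hconv (Nat.cast_nonneg k)]
  have : ∃ a : ℤ, ((k : ℕ) : ℝ) = a := ⟨k, by simp⟩
  simp [this, Prod.smul_mk, mem_generatedCone_iff hne hq hQ]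

/-- The directions of `Q` sit at height `0`, and a single point of `Q` at height `1` supplies the
rest. This yields both the exponent `polytopeDim Q + 1` and the position of the apex. -/
theorem span_range_eq (hne : Q.Nonempty) (hq : 0 < q)
    (hQ : (q : ℝ) • Q = convexHull ℝ (Set.range v)) {p : κ → ℝ} (hp : p ∈ Q) :
    Submodule.span ℝ (Set.range fun i => ((v i, (q : ℝ)) : (κ → ℝ) × ℝ)) =
      (vectorSpan ℝ Q).map (LinearMap.inl ℝ (κ → ℝ) ℝ) ⊔
        Submodule.span ℝ {((p, 1) : (κ → ℝ) × ℝ)} := by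
  have hq' : (0 : ℝ) < q := Nat.cast_pos.2 hq
  have hmem : ∀ y ∈ Q, ((y, 1) : (κ → ℝ) × ℝ) ∈
      Submodule.span ℝ (Set.range fun i => ((v i, (q : ℝ)) : (κ → ℝ) × ℝ)) := fun y hy =>
    generatedCone_subset_span _ ((mem_generatedCone_iff hne hq hQ).2
      ⟨zero_le_one, by rwa [one_smul]⟩)
  apply le_antisymm
  · rw [Submodule.span_le]
    rintro _ ⟨i, rfl⟩
    obtain ⟨y, hy, hyv⟩ : v i ∈ (q : ℝ) • Q :=
      hQ ▸ subset_convexHull ℝ _ (Set.mem_range_self i)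
    have hyv' : (q : ℝ) • y = v i := hyv
    have h1 : LinearMap.inl ℝ (κ → ℝ) ℝ ((q : ℝ) • (y - p)) ∈
        (vectorSpan ℝ Q).map (LinearMap.inl ℝ (κ → ℝ) ℝ) :=
      Submodule.mem_map_of_mem (Submodule.smul_mem _ _ (vsub_mem_vectorSpan ℝ hy hp))
    have h2 : (q : ℝ) • ((p, 1) : (κ → ℝ) × ℝ) ∈ Submodule.span ℝ {((p, 1) : (κ → ℝ) × ℝ)} :=
      Submodule.smul_mem _ _ (Submodule.mem_span_singleton_self _)
    have h3 : ((v i, (q : ℝ)) : (κ → ℝ) × ℝ) =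
        LinearMap.inl ℝ (κ → ℝ) ℝ ((q : ℝ) • (y - p)) + (q : ℝ) • ((p, 1) : (κ → ℝ) × ℝ) := by
      ext1
      · simp [← hyv', smul_sub]
      · simp
    beta_reduce
    rw [SetLike.mem_coe, h3]
    exact Submodule.add_mem_sup h1 h2
  · refine sup_le ?_ ?_
    · rw [vectorSpan_def, Submodule.map_span, Submodule.span_le]
      rintro _ ⟨_, ⟨y, hy, z, hz, rfl⟩, rfl⟩
      have := Submodule.sub_mem _ (hmem y hy) (hmem z hz)
      simpa using this
    · rw [Submodule.span_singleton_le_iff_mem]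
      exact hmem p hp

theorem apex_notMem_span (hne : Q.Nonempty) (hq : 0 < q)
    (hQ : (q : ℝ) • Q = convexHull ℝ (Set.range v)) {x : κ → ℝ} (hx : x ∉ affineSpan ℝ Q) :
    ((x, 1) : (κ → ℝ) × ℝ) ∉
      Submodule.span ℝ (Set.range fun i => ((v i, (q : ℝ)) : (κ → ℝ) × ℝ)) := by
  obtain ⟨p, hp⟩ := hne
  rw [span_range_eq ⟨p, hp⟩ hq hQ hp, Submodule.mem_sup]
  rintro ⟨_, ⟨z, hz, rfl⟩, w, hw, hsum⟩
  obtain ⟨a, rfl⟩ := Submodule.mem_span_singleton.1 hw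
  simp only [LinearMap.inl_apply, Prod.smul_mk, Prod.mk_add_mk, Prod.mk.injEq, smul_eq_mul,
    mul_one, zero_add] at hsum
  obtain ⟨h1, rfl⟩ := hsum
  apply hx
  rw [← h1, one_smul]
  exact AffineSubspace.vadd_mem_of_mem_direction ((direction_affineSpan ℝ Q).symm ▸ hz)
    (subset_affineSpan ℝ Q hp)

theorem finrank_span_range [Finite κ] (hne : Q.Nonempty) (hq : 0 < q)
    (hQ : (q : ℝ) • Q = convexHull ℝ (Set.range v)) :
    Module.finrank ℝ (Submodule.span ℝ (Set.range fun i => ((v i, (q : ℝ)) : (κ → ℝ) × ℝ))) =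
      polytopeDim Q + 1 := by
  obtain ⟨p, hp⟩ := hne
  have hp0 : ((p, 1) : (κ → ℝ) × ℝ) ≠ 0 := by simp
  have h := Submodule.finrank_sup_add_finrank_inf_eq
    ((vectorSpan ℝ Q).map (LinearMap.inl ℝ (κ → ℝ) ℝ)) (Submodule.span ℝ {((p, 1) : (κ → ℝ) × ℝ)})
  have hinf : (vectorSpan ℝ Q).map (LinearMap.inl ℝ (κ → ℝ) ℝ) ⊓
      Submodule.span ℝ {((p, 1) : (κ → ℝ) × ℝ)} = ⊥ := by
    rw [eq_bot_iff]
    rintro _ ⟨⟨z, -, rfl⟩, hw⟩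
    obtain ⟨a, ha⟩ := Submodule.mem_span_singleton.1 hw
    simp only [LinearMap.inl_apply, Prod.smul_mk, Prod.mk.injEq, smul_eq_mul, mul_one] at ha
    simp [← ha.1, ha.2]
  rw [hinf, finrank_bot, add_zero, finrank_span_singleton hp0,
    ← (Submodule.equivMapOfInjective _ LinearMap.inl_injective _).finrank_eq] at h
  rw [span_range_eq ⟨p, hp⟩ hq hQ hp, h, polytopeDim]

end ConeOverPolytope

/-! ### The polynomial statements for a polytope and its pyramid -/

section Pyramid

variable {κ : Type*} {Q : Set (κ → ℝ)} {q : ℕ}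

theorem IsLatticePolytope.exists_range {S : Set (κ → ℝ)} (hS : IsLatticePolytope S) :
    ∃ (N : ℕ) (v : Fin N → κ → ℝ), (∀ i, IsIntegralPoint (v i)) ∧
      S = convexHull ℝ (Set.range v) := by
  obtain ⟨V, -, hV, rfl⟩ := hS
  refine ⟨V.card, fun i => V.equivFin.symm i, fun i => hV _ (V.equivFin.symm i).2, ?_⟩
  congr 1
  ext y
  constructor
  · exact fun hy => ⟨V.equivFin ⟨y, hy⟩, by simp⟩
  · rintro ⟨i, rfl⟩
    exact (V.equivFin.symm i).2

theorem IsLatticePolytope.nonempty_of_smul {c : ℝ} (hQ : IsLatticePolytope (c • Q)) :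
    Q.Nonempty := by
  obtain ⟨V, hne, -, h⟩ := hQ
  rw [← Set.smul_set_nonempty (a := c), h]
  exact convexHull_nonempty_iff.2 (Finset.coe_nonempty.2 hne)

theorem IsLatticePolytope.convex_of_smul (hq : 0 < q) (hQ : IsLatticePolytope ((q : ℝ) • Q)) :
    Convex ℝ Q := by
  obtain ⟨V, -, -, h⟩ := hQ
  have hq' : (q : ℝ) ≠ 0 := (Nat.cast_pos.2 hq).ne'
  rw [← inv_smul_smul₀ hq' Q, h]
  exact (convex_convexHull ℝ _).smul _

theorem mem_integralLattice_generator {v : κ → ℝ} (hv : IsIntegralPoint v) (q : ℕ) :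
    (v, (q : ℝ)) ∈ integralLattice κ :=
  ⟨hv, q, by simp⟩

variable [Fintype κ]

theorem isNonnegPolynomial_ehrhartSeries (hq : 0 < q) (hQ : IsLatticePolytope ((q : ℝ) • Q)) :
    IsNonnegPolynomial ((1 - PowerSeries.X ^ q) ^ (polytopeDim Q + 1) * ehrhartSeries Q) := by
  have hne := hQ.nonempty_of_smul
  obtain ⟨N, v, hv, hQv⟩ := hQ.exists_range
  have h := isNonnegPolynomial_levelSeries_generatedCone (ht := LinearMap.snd ℝ (κ → ℝ) ℝ)
    (V := fun i => (v i, (q : ℝ))) finite_integralLattice_norm_le hq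
    (fun i => mem_integralLattice_generator (hv i) q) (fun _ => rfl)
  rwa [finrank_span_range hne hq hQv, levelSeries_generatedCone hne hq hQv] at h

theorem isNonnegPolynomial_pyramid_sub (hq : 0 < q) (hQ : IsLatticePolytope ((q : ℝ) • Q))
    {x : κ → ℝ} (hx : x ∉ affineSpan ℝ Q) {r : ℕ} (hr : 0 < r)
    (hrx : IsIntegralPoint ((r : ℝ) • x)) :
    IsNonnegPolynomial ((1 - PowerSeries.X ^ q) ^ (polytopeDim Q + 1) *
        (1 - PowerSeries.X ^ r) * ehrhartSeries (convexHull ℝ (insert x Q)) -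
      (1 - PowerSeries.X ^ q) ^ (polytopeDim Q + 1) * ehrhartSeries Q) := by
  have hne := hQ.nonempty_of_smul
  obtain ⟨N, v, hv, hQv⟩ := hQ.exists_range
  have h := isNonnegPolynomial_levelSeries_pyramid_sub (ht := LinearMap.snd ℝ (κ → ℝ) ℝ)
    (V := fun i => (v i, (q : ℝ))) finite_integralLattice_norm_le hq
    (fun i => mem_integralLattice_generator (hv i) q) (fun _ => rfl) (x := (x, 1)) rfl
    (apex_notMem_span hne hq hQv hx) hr
    (by simpa using mem_integralLattice_generator hrx r)
  rwa [finrank_span_range hne hq hQv, levelSeries_generatedCone hne hq hQv,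
    levelSeries_pyramid hne (hQ.convex_of_smul hq) hq hQv] at h

/-- The pyramid over a polytope in a coordinate hyperplane with an integral apex at height one. -/
theorem one_sub_X_mul_ehrhartSeries_pyramid (hq : 0 < q) (hQ : IsLatticePolytope ((q : ℝ) • Q))
    {x : κ → ℝ} (hx : IsIntegralPoint x) {i : κ} (hQi : ∀ y ∈ Q, y i = 0) (hxi : x i = 1) :
    (1 - PowerSeries.X) * ehrhartSeries (convexHull ℝ (insert x Q)) = ehrhartSeries Q := by
  have hne := hQ.nonempty_of_smul
  obtain ⟨N, v, hv, hQv⟩ := hQ.exists_range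
  have hxQ : x ∉ affineSpan ℝ Q := by
    intro hmem
    have hle : affineSpan ℝ Q ≤
        (LinearMap.ker (LinearMap.proj (R := ℝ) (φ := fun _ : κ => ℝ) i)).toAffineSubspace :=
      affineSpan_le.2 fun y hy => hQi y hy
    have : x i = 0 := hle hmem
    rw [hxi] at this
    exact one_ne_zero this
  have hxspan := apex_notMem_span hne hq hQv hxQ
  have hVL : ∀ j, (v j, (q : ℝ)) ∈ integralLattice κ :=
    fun j => mem_integralLattice_generator (hv j) q
  have h := one_sub_X_pow_mul_levelSeries_pyramid_eq (ht := LinearMap.snd ℝ (κ → ℝ) ℝ)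
    (V := fun i => (v i, (q : ℝ))) finite_integralLattice_norm_le hq hVL (fun _ => rfl)
    (x := (x, 1)) rfl hxspan (r := 1) one_pos
    (by simpa using mem_integralLattice_generator hx 1) (by
      rintro t h0 h1 ⟨y, s⟩ ⟨hy, -⟩ hmem
      rw [Prod.smul_mk, Prod.mk_sub_mk, mem_generatedCone_iff hne hq hQv] at hmem
      obtain ⟨-, z, hz, hzy⟩ := hmem
      obtain ⟨a, ha⟩ := hy i
      have hzi := congrFun hzy i
      simp only [Pi.smul_apply, Pi.sub_apply, hQi z hz, hxi, smul_eq_mul, mul_zero,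
        mul_one] at hzi
      -- The base has `i`-th coordinate `0` and the apex `1`, so `t` is the `i`-th coordinate of an
      -- integral point; in `[0, 1)` this leaves only `0`.
      have hta : t = a := by linarith
      rw [hta] at h0 h1 ⊢
      have h2 : (0 : ℤ) ≤ a := by exact_mod_cast h0
      have h3 : a < 1 := by exact_mod_cast h1
      have : a = 0 := by omega
      simp [this])
  rwa [levelSeries_pyramid hne (hQ.convex_of_smul hq) hq hQv,
    levelSeries_generatedCone hne hq hQv, pow_one] at h

end Pyramid

/-! ### Passing from `P` to its copy in the hyperplane -/

section Lift

variable {n : ℕ}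

/-- The embedding of `ℝ^n` as the last coordinate hyperplane of `ℝ^(n+1)`. -/
def hyperplaneEmbedding (n : ℕ) : (Fin n → ℝ) →ₗ[ℝ] (Fin (n + 1) → ℝ) where
  toFun v := Fin.snoc v 0
  map_add' v w := by
    ext i
    refine Fin.lastCases ?_ (fun j => ?_) i <;> simp
  map_smul' c v := by
    ext i
    refine Fin.lastCases ?_ (fun j => ?_) i <;> simp

theorem hyperplaneEmbedding_injective : Function.Injective (hyperplaneEmbedding n) := by
  intro v w h
  ext i
  simpa [hyperplaneEmbedding] using congrFun h i.castSucc

theorem liftToHyperplane_eq_image (P : Set (Fin n → ℝ)) :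
    liftToHyperplane P = hyperplaneEmbedding n '' P := rfl

theorem isIntegralPoint_hyperplaneEmbedding {v : Fin n → ℝ} :
    IsIntegralPoint (hyperplaneEmbedding n v) ↔ IsIntegralPoint v := by
  constructor
  · intro h i
    simpa [hyperplaneEmbedding] using h i.castSucc
  · intro h i
    refine Fin.lastCases ⟨0, by simp [hyperplaneEmbedding]⟩ (fun j => ?_) i
    simpa [hyperplaneEmbedding] using h j

theorem smul_liftToHyperplane (c : ℝ) (P : Set (Fin n → ℝ)) :
    c • liftToHyperplane P = hyperplaneEmbedding n '' (c • P) := by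
  rw [liftToHyperplane_eq_image, ← image_smul_set]

theorem isLatticePolytope_smul_liftToHyperplane {c : ℝ} {P : Set (Fin n → ℝ)}
    (h : IsLatticePolytope (c • P)) : IsLatticePolytope (c • liftToHyperplane P) := by
  classical
  obtain ⟨V, hne, hV, hP⟩ := h
  refine ⟨V.image (hyperplaneEmbedding n), hne.image _, ?_, ?_⟩
  · intro w hw
    obtain ⟨v, hv, rfl⟩ := Finset.mem_image.1 hw
    exact isIntegralPoint_hyperplaneEmbedding.2 (hV v hv)
  · rw [smul_liftToHyperplane, hP, LinearMap.image_convexHull, Finset.coe_image]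

theorem ehrhartSeries_liftToHyperplane (P : Set (Fin n → ℝ)) :
    ehrhartSeries (liftToHyperplane P) = ehrhartSeries P := by
  have : ∀ k, ehrhartCount (liftToHyperplane P) k = ehrhartCount P k := by
    intro k
    rw [ehrhartCount, ehrhartCount, smul_liftToHyperplane,
      ← Set.ncard_image_of_injective {v | v ∈ (k : ℝ) • P ∧ IsIntegralPoint v}
        hyperplaneEmbedding_injective]
    congr 1
    ext w
    constructor
    · rintro ⟨⟨v, hv, rfl⟩, hw⟩
      exact ⟨v, ⟨hv, isIntegralPoint_hyperplaneEmbedding.1 hw⟩, rfl⟩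
    · rintro ⟨v, ⟨hv, hi⟩, rfl⟩
      exact ⟨⟨v, hv, rfl⟩, isIntegralPoint_hyperplaneEmbedding.2 hi⟩
  simp only [ehrhartSeries, this]

theorem polytopeDim_liftToHyperplane (P : Set (Fin n → ℝ)) :
    polytopeDim (liftToHyperplane P) = polytopeDim P := by
  have h := AffineMap.map_vectorSpan (hyperplaneEmbedding n).toAffineMap
    (s := P)
  rw [polytopeDim, polytopeDim, liftToHyperplane_eq_image]
  change Module.finrank ℝ (vectorSpan ℝ ((hyperplaneEmbedding n).toAffineMap '' P)) = _
  rw [← h]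
  exact (Submodule.equivMapOfInjective _ hyperplaneEmbedding_injective _).finrank_eq.symm

end Lift

/-- Here `n = d - 1`. In both parts the `h*`-polynomials are polynomials whose coercions to
power series are the prescribed multiples of the Ehrhart series. If `P` is full-dimensional,
then `polytopeDim P + 1 = n + 1 = d`. -/
theorem mainTheorem7 {n : ℕ} (P : Set (Fin n → ℝ)) (hP : IsRationalPolytope P)
    (q : ℕ) (hq : IsDenominator P q) :
    (∃ hstarP hstarPyr : ℤ[X],
      (hstarP : ℤ⟦X⟧) = (1 - PowerSeries.X ^ q) ^ (n + 1) * ehrhartSeries P ∧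
      (hstarPyr : ℤ⟦X⟧) = (1 - PowerSeries.X ^ q) ^ (n + 1) * (1 - PowerSeries.X) *
        ehrhartSeries (Pyr (Pi.single (Fin.last n) 1) P) ∧
      hstarP = hstarPyr) ∧
    (∀ (r : ℕ) (x : Fin (n + 1) → ℝ), 0 < r → IsIntegralPoint ((r : ℝ) • x) →
      x ∉ affineSpan ℝ (liftToHyperplane P) →
      ∃ hstarP hstarPyr : ℤ[X],
        (hstarP : ℤ⟦X⟧) =
          (1 - PowerSeries.X ^ q) ^ (polytopeDim P + 1) * ehrhartSeries P ∧
        (hstarPyr : ℤ⟦X⟧) =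
          (1 - PowerSeries.X ^ q) ^ (polytopeDim P + 1) * (1 - PowerSeries.X ^ r) *
            ehrhartSeries (Pyr x P) ∧
        ∀ i : ℕ, hstarP.coeff i ≤ hstarPyr.coeff i) := by
  obtain ⟨hq0, hlat⟩ := hq.1
  have hlift := isLatticePolytope_smul_liftToHyperplane hlat
  obtain ⟨p, hp, -⟩ := isNonnegPolynomial_ehrhartSeries hq0 hlat
  constructor
  · have hdim : polytopeDim P ≤ n := by
      simpa [polytopeDim] using Submodule.finrank_le (vectorSpan ℝ P)
    -- Since `P` need not be full-dimensional, the exponent `n + 1` may exceed `polytopeDim P + 1`;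
    -- the surplus factors are polynomials.
    have hpn : (((1 - Polynomial.X ^ q) ^ (n - polytopeDim P) * p : ℤ[X]) : ℤ⟦X⟧) =
        (1 - PowerSeries.X ^ q) ^ (n + 1) * ehrhartSeries P := by
      rw [Polynomial.coe_mul, hp, ← mul_assoc, Polynomial.coe_pow, Polynomial.coe_sub,
        Polynomial.coe_one, Polynomial.coe_pow, Polynomial.coe_X, ← pow_add]
      congr 2
      omega
    refine ⟨_, _, hpn, ?_, rfl⟩
    have hpyr := one_sub_X_mul_ehrhartSeries_pyramid hq0 hlift
      (x := Pi.single (Fin.last n) 1) (i := Fin.last n) (fun i => ?_) ?_ (by simp)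
    · rw [hpn, mul_assoc, Pyr, hpyr, ehrhartSeries_liftToHyperplane]
    · by_cases hi : i = Fin.last n
      · exact ⟨1, by simp [hi]⟩
      · exact ⟨0, by simp [hi]⟩
    · rintro _ ⟨v, -, rfl⟩
      simp
  · intro r x hr hrx hx
    obtain ⟨p', hp', hnn⟩ := isNonnegPolynomial_pyramid_sub hq0 hlift hx hr hrx
    rw [polytopeDim_liftToHyperplane, ehrhartSeries_liftToHyperplane] at hp'
    refine ⟨p, p + p', hp, ?_, fun i => ?_⟩
    · rw [Polynomial.coe_add, hp, hp', add_sub_cancel, Pyr]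
    · rw [Polynomial.coeff_add]
      exact le_add_of_nonneg_right (hnn i)
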